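/- **Theorem 3.6 (Koszul homology).** Let $n\ge 1$ and let $(M,\Omega)$ be a multisymplectic manifold: $M$ is a smooth finite-dimensional manifold and $\Omega$ is a closed smooth $(n+1)$-form which is 1-nondegenerate ($v\lrcorner\Omega_x=0$ only for $v=0$). Let a Lie group $G$ with Lie algebra $\mathfrak g$ act smoothly on $M$ preserving $\Omega$, let $\xi_M$ denote the vector field on $M$ induced by $\xi\in\mathfrak g$, and let a covariant momentum map be given, that is, a linear assignment $\xi\mapsto\delta(\xi)$ of Hamiltonian $(n-1)$-forms (the covariant Noether currents) with $d\delta(\xi)=\xi_M\lrcorner\Omega$ for all $\xi\in\mathfrak g$. For $0\le p\le n-1$ a $p$-form $F$ is called Hamiltonian if $dF=X\lrcorner\Omega$ for some smooth $(n-p)$-vector field $X$; let $\tilde{\mathcal H}^p(M,\Omega)$ be the real vector space of Hamiltonian $p$-forms modulo closed $p$-forms, and $\tilde{\mathcal H}^*(M,\Omega)=\bigoplus_{p=0}^{n-1}\tilde{\mathcal H}^p(M,\Omega)$, graded by form degree. Let $\mathfrak W$ be the real vector space of $n$-forms spanned by the $d\delta(\xi)$, $\xi\in\mathfrak g$ (equivalently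 by the $d\delta(\xi_a)$ for a basis $(\xi_a)$ of $\mathfrak g$), placed in degree $n$. For a graded real vector space $V$, let $\Lambda^*(V)$ be the tensor algebra of $V$ modulo the two-sided ideal generated by the elements $x\otimes y-(-1)^{pq}\,y\otimes x$ with $x,y\in V$ homogeneous of degrees $p,q$. The algebra of observables is $\Lambda^*(\tilde{\mathcal H}^*(M,\Omega))$. Write $\Lambda^*(\tilde{\mathcal H}^*(M,\Omega))\wedge\Lambda^*(\mathfrak W)$ for $\Lambda^*(\tilde{\mathcal H}^*(M,\Omega)\oplus\mathfrak W)$ and $\Lambda^*(\tilde{\mathcal H}^*(M,\Omega))\wedge\Lambda^r(\mathfrak W)$ for its subspace spanned by the products $F\wedge w_1\wedge\dots\wedge w_r$ with $F$ an observable and $w_i\in\mathfrak W$. The Koszul differential $\mathfrak d_K$ is the right derivation $$(a\wedge b)\,\mathfrak d_K=a\wedge (b\,\mathfrak d_K)+(-1)^{|b|}(a\,\mathfrak d_K)\wedge b$$ ($|b|$ the total form degree of $b$) that is $0$ on $\tilde{\mathcal H}^*(M,\Omega)$ and sends $d\delta(\xi)\in\mathfrak W$ to the class of $\delta(\xi)$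 in $\tilde{\mathcal H}^{n-1}(M,\Omega)$. It satisfies $\mathfrak d_K^2=0$ and maps $\Lambda^*(\tilde{\mathcal H}^*)\wedge\Lambda^{r+1}(\mathfrak W)$ into $\Lambda^*(\tilde{\mathcal H}^*)\wedge\Lambda^{r}(\mathfrak W)$; let $H^r_{\mathfrak d_K}$ be the homology of the resulting complex at $\Lambda^*(\tilde{\mathcal H}^*)\wedge\Lambda^{r}(\mathfrak W)$, $r\ge 0$. Then $$H^r_{\mathfrak d_K}\bigl[\Lambda^*(\tilde{\mathcal H}^*(M,\Omega))\wedge\Lambda^*(\mathfrak W)\bigr]\;\cong\;\begin{cases}0 & r>0,\\[4pt] \dfrac{\Lambda^*(\tilde{\mathcal H}^*(M,\Omega))}{\Lambda^*(\tilde{\mathcal H}^*(M,\Omega))\wedge\delta[\mathfrak g]} & r=0,\end{cases}$$ where $\Lambda^*(\tilde{\mathcal H}^*(M,\Omega))\wedge\delta[\mathfrak g]$ is the ideal generated by the covariant Noether currents, and the isomorphism for $r=0$ sends the class of an observable $F$ to the homology class of $F\wedge 1$. The quotient in degree $0$ is called the algebra of observables on the constraint submanifold $\{\delta(\xi)=0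 \text{ for all }\xi\in\mathfrak g\}$. -/

import Mathlib

open scoped Manifold ContDiff DirectSum

noncomputable section

/-! ## Free graded-commutative algebras -/

namespace GradedComm

variable {V : Type*} [AddCommGroup V] [Module ℝ V]

/-- The relations `x ⊗ y - (-1)^(pq) y ⊗ x`, for `x` homogeneous of degree `p` and `y` homogeneous
of degree `q`, in the tensor algebra over a vector space `V` with subspaces `𝒱 p` of homogeneous
vectors of degree `p`. -/
inductive Rel (𝒱 : ℕ → Submodule ℝ V) : TensorAlgebra ℝ V → TensorAlgebra ℝ V → Prop
  | comm (p q : ℕ) (x y : V) (hx : x ∈ 𝒱 p) (hy : y ∈ 𝒱 q) :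
      Rel 𝒱 (TensorAlgebra.ι ℝ x * TensorAlgebra.ι ℝ y)
        ((-1 : ℝ) ^ (p * q) • (TensorAlgebra.ι ℝ y * TensorAlgebra.ι ℝ x))

/-- The exterior algebra `Λ*(V)` over a graded vector space: the quotient of the tensor algebra by
the two-sided ideal generated by the elements `x ⊗ y - (-1)^(pq) y ⊗ x`. -/
def Alg (𝒱 : ℕ → Submodule ℝ V) : Type _ := RingQuot (Rel 𝒱)

variable (𝒱 : ℕ → Submodule ℝ V)

instance : Ring (Alg 𝒱) := inferInstanceAs (Ring (RingQuot (Rel 𝒱)))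

instance : Algebra ℝ (Alg 𝒱) := inferInstanceAs (Algebra ℝ (RingQuot (Rel 𝒱)))

/-- The inclusion of the generators. -/
def ι : V →ₗ[ℝ] Alg 𝒱 :=
  (RingQuot.mkAlgHom ℝ (Rel 𝒱)).toLinearMap ∘ₗ TensorAlgebra.ι ℝ

theorem ι_mul_ι {p q : ℕ} {x y : V} (hx : x ∈ 𝒱 p) (hy : y ∈ 𝒱 q) :
    ι 𝒱 x * ι 𝒱 y = (-1 : ℝ) ^ (p * q) • (ι 𝒱 y * ι 𝒱 x) := by
  have h := RingQuot.mkAlgHom_rel ℝ (Rel.comm (𝒱 := 𝒱) p q x y hx hy)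
  rw [map_smul, map_mul, map_mul] at h
  exact h

section lift

variable {B : Type*} [Ring B] [Algebra ℝ B]

/-- The universal property. -/
def lift (f : V →ₗ[ℝ] B)
    (hf : ∀ (p q : ℕ) (x y : V), x ∈ 𝒱 p → y ∈ 𝒱 q →
      f x * f y = (-1 : ℝ) ^ (p * q) • (f y * f x)) : Alg 𝒱 →ₐ[ℝ] B :=
  RingQuot.liftAlgHom ℝ ⟨TensorAlgebra.lift ℝ f, by
    rintro _ _ ⟨p, q, x, y, hx, hy⟩
    simpa using hf p q x y hx hy⟩

@[simp]
theorem lift_ι (f : V →ₗ[ℝ] B)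
    (hf : ∀ (p q : ℕ) (x y : V), x ∈ 𝒱 p → y ∈ 𝒱 q →
      f x * f y = (-1 : ℝ) ^ (p * q) • (f y * f x)) (v : V) :
    lift 𝒱 f hf (ι 𝒱 v) = f v := by
  have h := RingQuot.liftAlgHom_mkAlgHom_apply ℝ (TensorAlgebra.lift ℝ f) (s := Rel 𝒱) (by
    rintro _ _ ⟨p, q, x, y, hx, hy⟩
    simpa using hf p q x y hx hy) (TensorAlgebra.ι ℝ v)
  rw [TensorAlgebra.lift_ι_apply] at h
  exact h

end lift

theorem induction {C : Alg 𝒱 → Prop} (hr : ∀ r : ℝ, C (algebraMap ℝ _ r))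
    (hι : ∀ v, C (ι 𝒱 v)) (hmul : ∀ a b, C a → C b → C (a * b))
    (hadd : ∀ a b, C a → C b → C (a + b)) (a : Alg 𝒱) : C a := by
  obtain ⟨t, rfl⟩ := RingQuot.mkAlgHom_surjective ℝ (Rel 𝒱) a
  induction t using TensorAlgebra.induction with
  | algebraMap r => rw [AlgHom.commutes]; exact hr r
  | ι v => exact hι v
  | mul a b ha hb => rw [map_mul]; exact hmul _ _ ha hb
  | add a b ha hb => rw [map_add]; exact hadd _ _ ha hb

/-- The algebra homomorphism `Λ*(V) → Λ*(V')` induced by a degree-preserving linear map. -/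
def map {V' : Type*} [AddCommGroup V'] [Module ℝ V'] (𝒱' : ℕ → Submodule ℝ V') (f : V →ₗ[ℝ] V')
    (hf : ∀ p, ∀ v ∈ 𝒱 p, f v ∈ 𝒱' p) : Alg 𝒱 →ₐ[ℝ] Alg 𝒱' :=
  lift 𝒱 (ι 𝒱' ∘ₗ f) fun p q x y hx hy => ι_mul_ι 𝒱' (hf p x hx) (hf q y hy)

@[simp]
theorem map_ι {V' : Type*} [AddCommGroup V'] [Module ℝ V'] (𝒱' : ℕ → Submodule ℝ V')
    (f : V →ₗ[ℝ] V') (hf : ∀ p, ∀ v ∈ 𝒱 p, f v ∈ 𝒱' p) (v : V) :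
    map 𝒱 𝒱' f hf (ι 𝒱 v) = ι 𝒱' (f v) := by
  simp [map]

/-- The grading involution of `Λ*(V)`, the algebra automorphism with `v ↦ (-1)^p v` for `v`
homogeneous of degree `p`; here `s` is the involution `(-1)^p` of `V` itself. -/
def sign (s : V →ₗ[ℝ] V) (hs : ∀ p, ∀ v ∈ 𝒱 p, s v = (-1 : ℝ) ^ p • v) : Alg 𝒱 →ₐ[ℝ] Alg 𝒱 :=
  map 𝒱 𝒱 s fun p v hv => by rw [hs p v hv]; exact (𝒱 p).smul_mem _ hv

section RightDerivation

variable (s δ : V →ₗ[ℝ] V) (hs : ∀ p, ∀ v ∈ 𝒱 p, s v = (-1 : ℝ) ^ p • v)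
  (hδ₀ : ∀ v ∈ 𝒱 0, δ v = 0) (hδ : ∀ p, ∀ v ∈ 𝒱 (p + 1), δ v ∈ 𝒱 p)

/-- Auxiliary: the algebra homomorphism `a ↦ !![a, a𝔡; 0, ±a]`, whose multiplicativity is the
graded product rule `(ab)𝔡 = a (b𝔡) ± (a𝔡) b` in its upper right corner. -/
def rightDerAux : Alg 𝒱 →ₐ[ℝ] Matrix (Fin 2) (Fin 2) (Alg 𝒱) :=
  lift 𝒱
    { toFun := fun v => !![ι 𝒱 v, ι 𝒱 (δ v); 0, ι 𝒱 (s v)]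
      map_add' := fun v w => by ext i j; fin_cases i <;> fin_cases j <;> simp
      map_smul' := fun c v => by ext i j; fin_cases i <;> fin_cases j <;> simp }
    (by
      intro p q x y hx hy
      have hd : ∀ (p q : ℕ) (x y : V), x ∈ 𝒱 p → y ∈ 𝒱 q →
          ι 𝒱 x * ι 𝒱 (δ y) = (-1 : ℝ) ^ (p * q + p) • (ι 𝒱 (δ y) * ι 𝒱 x) := by
        intro p q x y hx hy
        cases q with
        | zero => simp [hδ₀ y hy]
        | succ q =>
          rw [ι_mul_ι 𝒱 hx (hδ q y hy)]
          congr 1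
          rw [show p * (q + 1) + p = p * q + 2 * p by ring, pow_add, pow_mul]
          simp
      have hsq : ∀ m : ℕ, (-1 : ℝ) ^ m * (-1 : ℝ) ^ m = 1 := fun m => by
        rw [← mul_pow]; simp
      ext i j
      fin_cases i <;> fin_cases j
      · simpa using ι_mul_ι 𝒱 hx hy
      · have h1 := hd p q x y hx hy
        have h2 := hd q p y x hy hx
        simp only [Fin.zero_eta, Fin.isValue, LinearMap.coe_mk, AddHom.coe_mk, Fin.mk_one,
          Matrix.mul_apply, Fin.sum_univ_two, Matrix.of_apply, Matrix.cons_val', Matrix.cons_val_zero,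
          Matrix.cons_val_one, Matrix.cons_val_fin_one, Matrix.smul_apply, hs p x hx, hs q y hy,
          map_smul, Algebra.mul_smul_comm, smul_add, smul_smul]
        rw [h1, h2, smul_smul, add_comm]
        congr 1
        · congr 1
          rw [pow_add, mul_comm q p, ← mul_assoc, hsq, one_mul]
        · rw [pow_add]
      · simp
      · have h := ι_mul_ι 𝒱 hx hy
        simp only [Fin.mk_one, Fin.isValue, LinearMap.coe_mk, AddHom.coe_mk, Matrix.mul_apply,
          Fin.sum_univ_two, Matrix.of_apply, Matrix.cons_val', Matrix.cons_val_zero,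
          Matrix.cons_val_one, Matrix.cons_val_fin_one, Matrix.smul_apply, hs p x hx, hs q y hy,
          map_smul, zero_mul, zero_add, smul_mul_smul_comm, h, smul_smul]
        congr 1
        ring)

/-- The right derivation of degree `-1` of `Λ*(V)` which extends the linear map `δ : V → V` of
degree `-1`. -/
def rightDer : Alg 𝒱 →ₗ[ℝ] Alg 𝒱 where
  toFun a := rightDerAux 𝒱 s δ hs hδ₀ hδ a 0 1
  map_add' a b := by simp
  map_smul' c a := by simp

theorem rightDerAux_apply (a : Alg 𝒱) :
    rightDerAux 𝒱 s δ hs hδ₀ hδ a =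
      !![a, rightDer 𝒱 s δ hs hδ₀ hδ a; 0, sign 𝒱 s hs a] := by
  have h00 : ∀ a, rightDerAux 𝒱 s δ hs hδ₀ hδ a 0 0 = a ∧
      rightDerAux 𝒱 s δ hs hδ₀ hδ a 1 0 = 0 ∧
      rightDerAux 𝒱 s δ hs hδ₀ hδ a 1 1 = sign 𝒱 s hs a := by
    intro a
    induction a using induction with
    | hr r => simp [Matrix.algebraMap_matrix_apply]
    | hι v => simp [rightDerAux, sign]
    | hmul a b ha hb =>
      simp [Matrix.mul_apply, Fin.sum_univ_two, ha, hb]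
    | hadd a b ha hb => simp [ha, hb]
  ext i j
  fin_cases i <;> fin_cases j
  · exact (h00 a).1
  · rfl
  · exact (h00 a).2.1
  · exact (h00 a).2.2

@[simp]
theorem rightDer_ι (v : V) : rightDer 𝒱 s δ hs hδ₀ hδ (ι 𝒱 v) = ι 𝒱 (δ v) := by
  simp [rightDer, rightDerAux]

@[simp]
theorem rightDer_algebraMap (r : ℝ) :
    rightDer 𝒱 s δ hs hδ₀ hδ (algebraMap ℝ _ r) = 0 := by
  simp [rightDer, Matrix.algebraMap_matrix_apply]

/-- The graded product rule for a right derivation of odd degree. -/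
theorem rightDer_mul (a b : Alg 𝒱) :
    rightDer 𝒱 s δ hs hδ₀ hδ (a * b) =
      a * rightDer 𝒱 s δ hs hδ₀ hδ b + rightDer 𝒱 s δ hs hδ₀ hδ a * sign 𝒱 s hs b := by
  have h := congrFun (congrFun (map_mul (rightDerAux 𝒱 s δ hs hδ₀ hδ) a b) 0) 1
  rw [rightDerAux_apply 𝒱 s δ hs hδ₀ hδ a, rightDerAux_apply 𝒱 s δ hs hδ₀ hδ b] at h
  rw [Matrix.mul_apply, Fin.sum_univ_two] at h
  exact h

end RightDerivation

end GradedComm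

/-! ## The Koszul complex -/

namespace Koszul

open GradedComm

variable {V W : Type*} [AddCommGroup V] [Module ℝ V] [AddCommGroup W] [Module ℝ W]
  (𝒱 : ℕ → Submodule ℝ V) (k : ℕ)

/-- The grading of the space of generators `V ⊕ W`, with `W` placed in degree `k + 1`. -/
def gens (W : Type*) [AddCommGroup W] [Module ℝ W] (p : ℕ) : Submodule ℝ (V × W) :=
  (𝒱 p).prod (if p = k + 1 then ⊤ else ⊥)

/-- The graded-commutative algebra `Λ*(V) ∧ Λ*(W)`, generated by `V` and by `W` in degree
`k + 1`. -/
abbrev KAlg (W : Type*) [AddCommGroup W] [Module ℝ W] : Type _ := Alg (gens 𝒱 k W)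

/-- The homomorphism `Λ*(V) → Λ*(V) ∧ Λ*(W)`, `F ↦ F ∧ 1`. -/
def obs (W : Type*) [AddCommGroup W] [Module ℝ W] : Alg 𝒱 →ₐ[ℝ] KAlg 𝒱 k W :=
  map 𝒱 (gens 𝒱 k W) (LinearMap.inl ℝ V W) fun _ _ hv => ⟨hv, Submodule.zero_mem _⟩

theorem obs_ι (W : Type*) [AddCommGroup W] [Module ℝ W] (v : V) :
    obs 𝒱 k W (ι 𝒱 v) = ι (gens 𝒱 k W) (v, 0) := map_ι _ _ _ _ v

/-- The inclusion `W → Λ*(V) ∧ Λ*(W)`, `w ↦ 1 ∧ w`. -/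
def wedge : W →ₗ[ℝ] KAlg 𝒱 k W := ι (gens 𝒱 k W) ∘ₗ LinearMap.inr ℝ V W

/-- The component `Λ*(V) ∧ Λ^r(W)`, spanned by the elements `F ∧ w₁ ∧ ⋯ ∧ w_r`. -/
def comp (W : Type*) [AddCommGroup W] [Module ℝ W] (r : ℕ) : Submodule ℝ (KAlg 𝒱 k W) :=
  Subalgebra.toSubmodule (obs 𝒱 k W).range * (LinearMap.range (wedge (W := W) 𝒱 k)) ^ r

/-- The degree involution on the generators. -/
def genSign (s : V →ₗ[ℝ] V) (W : Type*) [AddCommGroup W] [Module ℝ W] : V × W →ₗ[ℝ] V × W :=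
  s.prodMap ((-1 : ℝ) ^ (k + 1) • LinearMap.id)

theorem snd_eq_zero_of_mem_gens {p : ℕ} (hp : p ≠ k + 1) {v : V × W} (hv : v ∈ gens 𝒱 k W p) :
    v.2 = 0 := by
  have h := hv.2
  rw [if_neg hp] at h
  exact h

theorem genSign_apply (s : V →ₗ[ℝ] V) (hs : ∀ p, ∀ v ∈ 𝒱 p, s v = (-1 : ℝ) ^ p • v) (p : ℕ) :
    ∀ v ∈ gens 𝒱 k W p, genSign k s W v = (-1 : ℝ) ^ p • v := by
  rintro ⟨v, w⟩ hv
  have h1 : s v = (-1 : ℝ) ^ p • v := hs p v hv.1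
  by_cases hp : p = k + 1
  · subst hp
    simp [genSign, h1]
  · have h2 : w = 0 := snd_eq_zero_of_mem_gens 𝒱 k hp hv
    simp [genSign, h1, h2]

/-- The Koszul differential on the generators: `V ∋ F ↦ 0`, `W ∋ w ↦ ν w ∈ V`. -/
def genDiff (ν : W →ₗ[ℝ] V) : V × W →ₗ[ℝ] V × W :=
  LinearMap.inl ℝ V W ∘ₗ ν ∘ₗ LinearMap.snd ℝ V W

theorem genDiff_zero (ν : W →ₗ[ℝ] V) : ∀ v ∈ gens 𝒱 k W 0, genDiff ν v = 0 := by
  intro v hv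
  simp [genDiff, snd_eq_zero_of_mem_gens 𝒱 k (by omega) hv]

theorem genDiff_mem (ν : W →ₗ[ℝ] V) (hν : ∀ w, ν w ∈ 𝒱 k) (p : ℕ) :
    ∀ v ∈ gens 𝒱 k W (p + 1), genDiff ν v ∈ gens 𝒱 k W p := by
  intro v hv
  by_cases hp : p = k
  · subst hp
    exact ⟨hν v.2, Submodule.zero_mem _⟩
  · have h : genDiff ν v = 0 := by
      simp [genDiff, snd_eq_zero_of_mem_gens 𝒱 k (p := p + 1) (by omega) hv]
    rw [h]
    exact Submodule.zero_mem _

section Differential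

variable (s : V →ₗ[ℝ] V) (hs : ∀ p, ∀ v ∈ 𝒱 p, s v = (-1 : ℝ) ^ p • v)
  (ν : W →ₗ[ℝ] V) (hν : ∀ w, ν w ∈ 𝒱 k)

/-- The Koszul differential: the right derivation of degree `-1` of `Λ*(V) ∧ Λ*(W)` with
`F ↦ 0` for `F ∈ V` and `w ↦ ν w` for `w ∈ W`. -/
def diff : KAlg 𝒱 k W →ₗ[ℝ] KAlg 𝒱 k W :=
  rightDer (gens 𝒱 k W) (genSign k s W) (genDiff ν) (genSign_apply 𝒱 k s hs)
    (genDiff_zero 𝒱 k ν) (genDiff_mem 𝒱 k ν hν)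

theorem diff_mul (a b : KAlg 𝒱 k W) :
    diff 𝒱 k s hs ν hν (a * b) = a * diff 𝒱 k s hs ν hν b +
      diff 𝒱 k s hs ν hν a * sign _ (genSign k s W) (genSign_apply 𝒱 k s hs) b :=
  rightDer_mul _ _ _ _ _ _ a b

theorem diff_wedge (w : W) :
    diff 𝒱 k s hs ν hν (wedge 𝒱 k w) = obs 𝒱 k W (ι 𝒱 (ν w)) := by
  rw [obs_ι]
  simp [diff, wedge, genDiff]

theorem diff_obs (a : Alg 𝒱) : diff 𝒱 k s hs ν hν (obs 𝒱 k W a) = 0 := by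
  induction a using induction with
  | hr r => rw [AlgHom.commutes]; exact rightDer_algebraMap _ _ _ _ _ _ r
  | hι v =>
    rw [obs_ι, diff, rightDer_ι, show genDiff ν ((v, 0) : V × W) = 0 by simp [genDiff], map_zero]
  | hmul a b ha hb => rw [map_mul, diff_mul, ha, hb, mul_zero, zero_mul, add_zero]
  | hadd a b ha hb => rw [map_add, map_add, ha, hb, add_zero]

theorem sign_diff (a : KAlg 𝒱 k W) :
    sign _ (genSign k s W) (genSign_apply 𝒱 k s hs) (diff 𝒱 k s hs ν hν a) =
      - diff 𝒱 k s hs ν hν (sign _ (genSign k s W) (genSign_apply 𝒱 k s hs) a) := by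
  induction a using induction with
  | hr r =>
    have h : diff 𝒱 k s hs ν hν (algebraMap ℝ _ r) = 0 := rightDer_algebraMap _ _ _ _ _ _ r
    rw [AlgHom.commutes, h, map_zero, neg_zero]
  | hι v =>
    simp only [diff, sign, rightDer_ι, map_ι]
    rw [← map_neg]
    congr 1
    simp [genDiff, genSign, hs k _ (hν v.2), pow_succ]
  | hmul a b ha hb =>
    rw [diff_mul, map_add, map_mul, map_mul, map_mul, diff_mul, ha, hb]
    noncomm_ring
  | hadd a b ha hb => simp only [map_add, ha, hb]; abel

theorem diff_diff (a : KAlg 𝒱 k W) : diff 𝒱 k s hs ν hν (diff 𝒱 k s hs ν hν a) = 0 := by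
  induction a using induction with
  | hr r =>
    have h : diff 𝒱 k s hs ν hν (algebraMap ℝ _ r) = 0 := rightDer_algebraMap _ _ _ _ _ _ r
    rw [h, map_zero]
  | hι v =>
    rw [diff, rightDer_ι, rightDer_ι, show genDiff ν (genDiff ν v) = 0 by simp [genDiff], map_zero]
  | hmul a b ha hb =>
    rw [diff_mul, map_add, diff_mul, diff_mul, ha, hb, sign_diff]
    noncomm_ring
  | hadd a b ha hb => rw [map_add, map_add, ha, hb, add_zero]

/-- The cycles in `Λ*(V) ∧ Λ^r(W)`. -/
def cycles (r : ℕ) : Submodule ℝ (KAlg 𝒱 k W) :=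
  comp 𝒱 k W r ⊓ LinearMap.ker (diff 𝒱 k s hs ν hν)

/-- The image of `Λ*(V) ∧ Λ^(r+1)(W)` under the differential. -/
def boundaries (r : ℕ) : Submodule ℝ (KAlg 𝒱 k W) :=
  (comp 𝒱 k W (r + 1)).map (diff 𝒱 k s hs ν hν)

/-- The `r`-th homology, cycles modulo boundaries, of the complex
`⋯ → Λ*(V) ∧ Λ^(r+1)(W) → Λ*(V) ∧ Λ^r(W) → ⋯ → Λ*(V) ∧ Λ^0(W) → 0`. -/
abbrev homology (r : ℕ) : Type _ :=
  cycles 𝒱 k s hs ν hν r ⧸ (boundaries 𝒱 k s hs ν hν r).submoduleOf (cycles 𝒱 k s hs ν hν r)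

theorem obs_mem_cycles (a : Alg 𝒱) : obs 𝒱 k W a ∈ cycles 𝒱 k s hs ν hν 0 :=
  ⟨by rw [comp, pow_zero, mul_one]; exact ⟨a, rfl⟩, diff_obs 𝒱 k s hs ν hν a⟩

/-- The class of `F ∧ 1` in the homology in degree `0`. -/
def obsClass (a : Alg 𝒱) : homology 𝒱 k s hs ν hν 0 :=
  Submodule.Quotient.mk ⟨obs 𝒱 k W a, obs_mem_cycles 𝒱 k s hs ν hν a⟩

/-- Elements of `W` can be moved past elements of `Λ*(V)`. -/
theorem range_wedge_mul_le (hV : ⨆ p, 𝒱 p = ⊤) :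
    LinearMap.range (wedge (W := W) 𝒱 k) * Subalgebra.toSubmodule (obs 𝒱 k W).range ≤
      Subalgebra.toSubmodule (obs 𝒱 k W).range * LinearMap.range (wedge (W := W) 𝒱 k) := by
  rw [Submodule.mul_le]
  rintro _ ⟨w, rfl⟩ _ ⟨a, rfl⟩
  suffices h : ∀ w : W, wedge 𝒱 k w * obs 𝒱 k W a ∈
      Subalgebra.toSubmodule (obs 𝒱 k W).range * LinearMap.range (wedge (W := W) 𝒱 k) from h w
  induction a using induction with
  | hr r =>
    intro w
    rw [AlgHom.commutes, ← Algebra.commutes, ← (obs 𝒱 k W).commutes]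
    exact Submodule.mul_mem_mul ⟨_, rfl⟩ ⟨w, rfl⟩
  | hι v =>
    intro w
    have hv : v ∈ ⨆ p, 𝒱 p := hV ▸ Submodule.mem_top
    induction hv using Submodule.iSup_induction' with
    | mem p v hv =>
      have h : wedge 𝒱 k w * obs 𝒱 k W (ι 𝒱 v) =
          (-1 : ℝ) ^ ((k + 1) * p) • (obs 𝒱 k W (ι 𝒱 v) * wedge 𝒱 k w) := by
        rw [obs_ι]
        exact ι_mul_ι (gens 𝒱 k W) (p := k + 1) (q := p) (x := (0, w)) (y := (v, 0))
          ⟨Submodule.zero_mem _, by simp⟩ ⟨hv, Submodule.zero_mem _⟩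
      rw [h]
      exact Submodule.smul_mem _ _ (Submodule.mul_mem_mul ⟨_, rfl⟩ ⟨w, rfl⟩)
    | zero => simp
    | add x y _ _ hx hy => rw [map_add, map_add, mul_add]; exact Submodule.add_mem _ hx hy
  | hmul a b ha hb =>
    intro w
    rw [map_mul, ← mul_assoc]
    refine Submodule.mul_induction_on (ha w) ?_ ?_
    · rintro _ ⟨c, rfl⟩ _ ⟨u, rfl⟩
      have h := Submodule.mul_mem_mul
        (show obs 𝒱 k W c ∈ Subalgebra.toSubmodule (obs 𝒱 k W).range from ⟨c, rfl⟩) (hb u)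
      rw [← mul_assoc (Subalgebra.toSubmodule _), Subalgebra.isIdempotentElem_toSubmodule] at h
      rw [mul_assoc]
      exact h
    · intro x y hx hy
      rw [add_mul]
      exact Submodule.add_mem _ hx hy
  | hadd a b ha hb =>
    intro w
    rw [map_add, mul_add]
    exact Submodule.add_mem _ (ha w) (hb w)

theorem sign_mem_pow (r : ℕ) : ∀ a ∈ (LinearMap.range (wedge (W := W) 𝒱 k)) ^ r,
    sign _ (genSign k s W) (genSign_apply 𝒱 k s hs) a ∈
      (LinearMap.range (wedge (W := W) 𝒱 k)) ^ r := by
  intro a ha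
  induction r generalizing a with
  | zero =>
    rw [pow_zero, Submodule.one_eq_range] at ha ⊢
    obtain ⟨c, rfl⟩ := ha
    exact ⟨c, by simp⟩
  | succ r ih =>
    rw [pow_succ] at ha ⊢
    refine Submodule.mul_induction_on ha ?_ ?_
    · rintro a ha _ ⟨w, rfl⟩
      rw [map_mul]
      refine Submodule.mul_mem_mul (ih a ha) ⟨(-1 : ℝ) ^ (k + 1) • w, ?_⟩
      simp only [wedge, LinearMap.comp_apply, sign, map_ι]
      simp [genSign]
    · intro x y hx hy
      rw [map_add]
      exact Submodule.add_mem _ hx hy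

/-- The differential maps `Λ*(V) ∧ Λ^(r+1)(W)` into the cycles of `Λ*(V) ∧ Λ^r(W)`. -/
theorem boundaries_le_cycles (hV : ⨆ p, 𝒱 p = ⊤) (r : ℕ) :
    boundaries 𝒱 k s hs ν hν r ≤ cycles 𝒱 k s hs ν hν r := by
  set A := Subalgebra.toSubmodule (obs 𝒱 k W).range with hA
  set U := LinearMap.range (wedge (W := W) 𝒱 k) with hU
  have hAA : A * A = A := Subalgebra.isIdempotentElem_toSubmodule _
  have key : ∀ r : ℕ, ∀ u ∈ U ^ (r + 1), diff 𝒱 k s hs ν hν u ∈ A * U ^ r := by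
    intro r
    induction r with
    | zero =>
      intro u hu
      rw [zero_add, pow_one] at hu
      obtain ⟨w, rfl⟩ := hu
      rw [diff_wedge, pow_zero, mul_one]
      exact ⟨_, rfl⟩
    | succ r ih =>
      intro u hu
      rw [pow_succ'] at hu
      refine Submodule.mul_induction_on hu ?_ ?_
      · rintro _ ⟨w, rfl⟩ b hb
        rw [diff_mul, diff_wedge]
        refine Submodule.add_mem _ ?_ ?_
        · have h := Submodule.mul_mem_mul (show wedge 𝒱 k w ∈ U from ⟨w, rfl⟩) (ih b hb)
          rw [← mul_assoc] at h
          have h' := mul_le_mul' (range_wedge_mul_le (W := W) 𝒱 k hV)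
            (le_refl (U ^ r)) h
          rwa [mul_assoc, ← pow_succ'] at h'
        · exact Submodule.mul_mem_mul ⟨_, rfl⟩ (sign_mem_pow 𝒱 k s hs _ b hb)
      · intro x y hx hy
        rw [map_add]
        exact Submodule.add_mem _ hx hy
  rintro _ ⟨a, ha, rfl⟩
  refine ⟨?_, diff_diff 𝒱 k s hs ν hν a⟩
  refine Submodule.mul_induction_on ha ?_ ?_
  · rintro _ ⟨c, rfl⟩ b hb
    have h := Submodule.mul_mem_mul (show obs 𝒱 k W c ∈ A from ⟨c, rfl⟩) (key r b hb)
    rw [← mul_assoc, hAA] at h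
    have h0 := diff_obs 𝒱 k s hs ν hν c
    rw [diff_mul]
    change _ + diff 𝒱 k s hs ν hν (obs 𝒱 k W c) * _ ∈ _
    rw [h0, zero_mul, add_zero]
    exact h
  · intro x y hx hy
    rw [map_add]
    exact Submodule.add_mem _ hx hy

end Differential

/-- The ideal `Λ*(V) ∧ ν(W)` of `Λ*(V)` generated by the elements `ν w`. -/
def ideal (ν : W →ₗ[ℝ] V) : Ideal (Alg 𝒱) := Ideal.span (Set.range fun w => ι 𝒱 (ν w))

/-- The left ideal generated by homogeneous elements is two-sided. -/
theorem ideal_isTwoSided (hV : ⨆ p, 𝒱 p = ⊤) (ν : W →ₗ[ℝ] V) (hν : ∀ w, ν w ∈ 𝒱 k) :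
    (ideal 𝒱 ν).IsTwoSided := by
  constructor
  intro a b ha
  suffices h : ∀ w, ι 𝒱 (ν w) * b ∈ ideal 𝒱 ν by
    induction ha using Submodule.span_induction with
    | mem x hx => obtain ⟨w, rfl⟩ := hx; exact h w
    | zero => simp
    | add x y _ _ hx hy => rw [add_mul]; exact add_mem hx hy
    | smul c x _ hx => rw [smul_eq_mul, mul_assoc]; exact Ideal.mul_mem_left _ _ hx
  have hmem : ∀ w, ι 𝒱 (ν w) ∈ ideal 𝒱 ν := fun w => Ideal.subset_span ⟨w, rfl⟩
  have hsm : ∀ (c : ℝ) (x : Alg 𝒱), x ∈ ideal 𝒱 ν → c • x ∈ ideal 𝒱 ν := fun c x hx => by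
    rw [Algebra.smul_def]; exact Ideal.mul_mem_left _ _ hx
  suffices h : ∀ x ∈ ideal 𝒱 ν, x * b ∈ ideal 𝒱 ν from fun w => h _ (hmem w)
  induction b using induction with
  | hr r => intro x hx; rw [← Algebra.commutes]; exact Ideal.mul_mem_left _ _ hx
  | hι v =>
    intro x hx
    induction hx using Submodule.span_induction with
    | mem x hx =>
      obtain ⟨w, rfl⟩ := hx
      have hv : v ∈ ⨆ p, 𝒱 p := hV ▸ Submodule.mem_top
      induction hv using Submodule.iSup_induction' with
      | mem p v hv =>
        rw [ι_mul_ι 𝒱 (hν w) hv]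
        exact hsm _ _ (Ideal.mul_mem_left _ _ (hmem w))
      | zero => simp
      | add x y _ _ hx hy => rw [map_add, mul_add]; exact add_mem hx hy
    | zero => simp
    | add x y _ _ hx hy => rw [add_mul]; exact add_mem hx hy
    | smul c x _ hx => rw [smul_eq_mul, mul_assoc]; exact Ideal.mul_mem_left _ _ hx
  | hmul a b ha hb => intro x hx; rw [← mul_assoc]; exact hb _ (ha _ hx)
  | hadd a b ha hb => intro x hx; rw [mul_add]; exact add_mem (ha _ hx) (hb _ hx)

end Koszul

/-! ## Multisymplectic manifolds -/

namespace Multisymplectic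

variable (E M : Type*) [NormedAddCommGroup E] [NormedSpace ℝ E] [TopologicalSpace M]
  [ChartedSpace E M]

/-- Fields of alternating `p`-forms on the tangent spaces of `M`, without any regularity. -/
def FormField (p : ℕ) : Type _ := (x : M) → TangentSpace 𝓘(ℝ, E) x [⋀^Fin p]→L[ℝ] ℝ

instance (p : ℕ) : AddCommGroup (FormField E M p) :=
  inferInstanceAs (AddCommGroup ((x : M) → TangentSpace 𝓘(ℝ, E) x [⋀^Fin p]→L[ℝ] ℝ))

instance (p : ℕ) : Module ℝ (FormField E M p) :=
  inferInstanceAs (Module ℝ ((x : M) → TangentSpace 𝓘(ℝ, E) x [⋀^Fin p]→L[ℝ] ℝ))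

/-- Fields of `q`-vectors on `M`, without any regularity. -/
abbrev MultivectorField (q : ℕ) : Type _ := (x : M) → ⋀[ℝ]^q (TangentSpace 𝓘(ℝ, E) x)

variable {E M}

/-- The expression of a field of `p`-forms in the chart around `x₀`: its pullback by the inverse of
the chart. -/
def chartForm {p : ℕ} (η : FormField E M p) (x₀ : M) (y : E) : E [⋀^Fin p]→L[ℝ] ℝ :=
  (η ((extChartAt 𝓘(ℝ, E) x₀).symm y)).compContinuousLinearMap
    (mfderiv 𝓘(ℝ, E) 𝓘(ℝ, E) (extChartAt 𝓘(ℝ, E) x₀).symm y :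
      E →L[ℝ] TangentSpace 𝓘(ℝ, E) ((extChartAt 𝓘(ℝ, E) x₀).symm y))

variable (E M) in
/-- The space `Ω^p(M)` of smooth differential `p`-forms on `M`. -/
def Form (p : ℕ) : Submodule ℝ (FormField E M p) where
  carrier := {η | ∀ x₀, ContDiffOn ℝ ∞ (chartForm η x₀) (extChartAt 𝓘(ℝ, E) x₀).target}
  add_mem' := fun hη hθ x₀ => (hη x₀).add (hθ x₀)
  zero_mem' := fun _ => contDiffOn_const (c := 0)
  smul_mem' := fun c _ hη x₀ => (hη x₀).const_smul c

/-- The exterior derivative, computed at each point in the chart around that point. -/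
def extD {p : ℕ} : Form E M p →ₗ[ℝ] FormField E M (p + 1) where
  toFun η x := (extDeriv (chartForm η.1 x) (extChartAt 𝓘(ℝ, E) x x)).compContinuousLinearMap
    (mfderiv 𝓘(ℝ, E) 𝓘(ℝ, E) (extChartAt 𝓘(ℝ, E) x) x : TangentSpace 𝓘(ℝ, E) x →L[ℝ] E)
  map_add' := fun η θ => by
    funext x
    have h : ∀ ζ : Form E M p, DifferentiableAt ℝ (chartForm ζ.1 x) (extChartAt 𝓘(ℝ, E) x x) :=
      fun ζ => ((ζ.2 x).contDiffAt (extChartAt_target_mem_nhds x)).differentiableAt (by simp)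
    have h' : chartForm (η + θ).1 x = chartForm η.1 x + chartForm θ.1 x := rfl
    rw [h', extDeriv_add (h η) (h θ)]
    rfl
  map_smul' := fun c η => by
    funext x
    have h' : chartForm (c • η).1 x = c • chartForm η.1 x := rfl
    rw [h', extDeriv_smul]
    rfl

/-- Smoothness of a field of `q`-vectors: its components in any chart, that is, its pairings with
the pullbacks by the chart of constant `q`-covectors `α`, are smooth. -/
def IsSmooth {q : ℕ} (X : MultivectorField E M q) : Prop :=
  ∀ (x₀ : M) (α : E [⋀^Fin q]→ₗ[ℝ] ℝ), ContDiffOn ℝ ∞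
    (fun y : E => exteriorPower.alternatingMapLinearEquiv
      (α.compLinearMap
        (mfderiv 𝓘(ℝ, E) 𝓘(ℝ, E) (extChartAt 𝓘(ℝ, E) x₀) ((extChartAt 𝓘(ℝ, E) x₀).symm y) :
          TangentSpace 𝓘(ℝ, E) ((extChartAt 𝓘(ℝ, E) x₀).symm y) →L[ℝ] E).toLinearMap)
      (X ((extChartAt 𝓘(ℝ, E) x₀).symm y)))
    (extChartAt 𝓘(ℝ, E) x₀).target

section Contraction

theorem update_sum_elim {T : Type*} {q r m : ℕ} [DecidableEq (Fin q)] (h : q + r = m) (u : Fin q → T) (v : Fin r → T)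
    (i : Fin q) (c : T) :
    (fun j => Sum.elim (Function.update u i c) v (finSumFinEquiv.symm (Fin.cast h.symm j))) =
      Function.update (fun j => Sum.elim u v (finSumFinEquiv.symm (Fin.cast h.symm j)))
        (Fin.cast h (Fin.castAdd r i)) c := by
  subst h
  funext j
  refine Fin.addCases (fun a => ?_) (fun b => ?_) j
  · by_cases ha : a = i
    · subst ha; simp
    · simp [Function.update_of_ne, ha]
  · have hb : Fin.natAdd q b ≠ Fin.castAdd r i := by
      intro hb
      have := congrArg Fin.val hb
      simp at this
      omega
    simp [Function.update_of_ne hb]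

variable {T : Type*} [AddCommGroup T] [Module ℝ T] [TopologicalSpace T] {q r m : ℕ}

/-- The alternating map `u ↦ η(u₁, …, u_q, v₁, …, v_r)`. -/
def partialEval (h : q + r = m) (η : T [⋀^Fin m]→L[ℝ] ℝ) (v : Fin r → T) :
    T [⋀^Fin q]→ₗ[ℝ] ℝ where
  toFun u := η fun i => Sum.elim u v (finSumFinEquiv.symm (Fin.cast h.symm i))
  map_update_add' := by
    intro hdec u i a b
    classical
    have key : ∀ c : T, (fun j => Sum.elim (Function.update u i c) v
        (finSumFinEquiv.symm (Fin.cast h.symm j))) =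
        Function.update (fun j => Sum.elim u v (finSumFinEquiv.symm (Fin.cast h.symm j)))
          (Fin.cast h (Fin.castAdd r i)) c := fun c => update_sum_elim h u v i c
    rw [key, key, key]
    exact η.map_update_add _ _ _ _
  map_update_smul' := by
    intro hdec u i c a
    classical
    have key : ∀ c : T, (fun j => Sum.elim (Function.update u i c) v
        (finSumFinEquiv.symm (Fin.cast h.symm j))) =
        Function.update (fun j => Sum.elim u v (finSumFinEquiv.symm (Fin.cast h.symm j)))
          (Fin.cast h (Fin.castAdd r i)) c := fun c => update_sum_elim h u v i c
    rw [key, key]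
    exact η.map_update_smul _ _ _ _
  map_eq_zero_of_eq' := by
    intro u i j hij hne
    refine η.map_eq_zero_of_eq _ (i := Fin.cast h (Fin.castAdd r i))
      (j := Fin.cast h (Fin.castAdd r j)) ?_ ?_
    · simpa using hij
    · simpa [Fin.ext_iff] using hne

/-- The contraction `X ⌟ η` of an `m`-form with a `q`-vector, evaluated on `v₁, …, v_r`; for
`X = u₁ ∧ ⋯ ∧ u_q` it is `η(u₁, …, u_q, v₁, …, v_r)`. -/
def contract (h : q + r = m) (X : ⋀[ℝ]^q T) (η : T [⋀^Fin m]→L[ℝ] ℝ) (v : Fin r → T) : ℝ :=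
  exteriorPower.alternatingMapLinearEquiv (partialEval h η v) X

theorem contract_ιMulti (h : q + r = m) (u : Fin q → T) (η : T [⋀^Fin m]→L[ℝ] ℝ)
    (v : Fin r → T) : contract h (exteriorPower.ιMulti ℝ q u) η v =
      η fun i => Fin.append u v (Fin.cast h.symm i) := by
  rw [contract, exteriorPower.alternatingMapLinearEquiv_apply_ιMulti]
  change η _ = η _
  congr 1
  funext i
  generalize Fin.cast h.symm i = j
  refine Fin.addCases (fun a => ?_) (fun b => ?_) j <;> simp

theorem contract_add (h : q + r = m) (X Y : ⋀[ℝ]^q T) (η : T [⋀^Fin m]→L[ℝ] ℝ) (v : Fin r → T) :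
    contract h (X + Y) η v = contract h X η v + contract h Y η v := map_add _ X Y

theorem contract_smul (h : q + r = m) (c : ℝ) (X : ⋀[ℝ]^q T) (η : T [⋀^Fin m]→L[ℝ] ℝ)
    (v : Fin r → T) : contract h (c • X) η v = c * contract h X η v := map_smul _ c X

end Contraction

/-- A multisymplectic form: a closed, 1-nondegenerate `(n+1)`-form, where `n = k + 1 ≥ 1`. -/
structure IsMultisymplectic {k : ℕ} (Ω : Form E M (k + 2)) : Prop where
  closed : extD Ω = 0
  nondegenerate : ∀ (x : M) (v : TangentSpace 𝓘(ℝ, E) x),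
    (∀ w : Fin (k + 1) → TangentSpace 𝓘(ℝ, E) x, Ω.1 x (Fin.cons v w) = 0) → v = 0

variable {k : ℕ} (Ω : Form E M (k + 2))

/-- The space of Hamiltonian `p`-forms, `0 ≤ p ≤ n - 1 = k`: those `p`-forms `F` for which there is
a smooth `(n-p)`-vector field `X` with `X ⌟ Ω = dF`. -/
def hamiltonianForms (p : Fin (k + 1)) : Submodule ℝ (Form E M p) where
  carrier := {F | ∃ X : MultivectorField E M (k + 1 - p), IsSmooth X ∧
    ∀ (x : M) (v : Fin ((p : ℕ) + 1) → TangentSpace 𝓘(ℝ, E) x),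
      contract (by omega) (X x) (Ω.1 x) v = extD F x v}
  add_mem' := by
    rintro F F' ⟨X, hX, hF⟩ ⟨X', hX', hF'⟩
    refine ⟨fun x => X x + X' x, fun x₀ α => ?_, fun x v => ?_⟩
    · simp only [map_add]
      exact (hX x₀ α).add (hX' x₀ α)
    · rw [contract_add, hF, hF', map_add]
      rfl
  zero_mem' := by
    refine ⟨fun x => 0, fun x₀ α => ?_, fun x v => ?_⟩
    · simp only [map_zero]
      exact contDiffOn_const
    · rw [map_zero]
      exact map_zero _
  smul_mem' := by
    rintro c F ⟨X, hX, hF⟩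
    refine ⟨fun x => c • X x, fun x₀ α => ?_, fun x v => ?_⟩
    · simp only [map_smul]
      exact (hX x₀ α).const_smul c
    · rw [contract_smul, hF, map_smul]
      rfl

/-- The exterior derivative on Hamiltonian `p`-forms. -/
def hamD (p : Fin (k + 1)) : hamiltonianForms Ω p →ₗ[ℝ] FormField E M ((p : ℕ) + 1) :=
  extD ∘ₗ (hamiltonianForms Ω p).subtype

/-- Hamiltonian `p`-forms modulo closed `p`-forms. -/
def HamQuot (p : Fin (k + 1)) : Type _ := hamiltonianForms Ω p ⧸ LinearMap.ker (hamD Ω p)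

instance (p : Fin (k + 1)) : AddCommGroup (HamQuot Ω p) :=
  inferInstanceAs (AddCommGroup (hamiltonianForms Ω p ⧸ LinearMap.ker (hamD Ω p)))

instance (p : Fin (k + 1)) : Module ℝ (HamQuot Ω p) :=
  inferInstanceAs (Module ℝ (hamiltonianForms Ω p ⧸ LinearMap.ker (hamD Ω p)))

/-- The class of a Hamiltonian form modulo closed forms. -/
def HamQuot.mk (p : Fin (k + 1)) : hamiltonianForms Ω p →ₗ[ℝ] HamQuot Ω p :=
  (LinearMap.ker (hamD Ω p)).mkQ

/-- The graded vector space of Hamiltonian forms modulo closed forms. -/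
abbrev HamSpace : Type _ := ⨁ p : Fin (k + 1), HamQuot Ω p

/-- The subspace of homogeneous elements of form degree `p`; it is zero for `p ≥ n`. -/
def hamGrading (p : ℕ) : Submodule ℝ (HamSpace Ω) where
  carrier := {F | ∀ i : Fin (k + 1), (i : ℕ) ≠ p → F i = 0}
  add_mem' := fun {F G} hF hG i hi => by simp [hF i hi, hG i hi]
  zero_mem' := fun i _ => rfl
  smul_mem' := fun c F hF i hi => by simp [DirectSum.smul_apply, hF i hi]

/-- The graded-commutative algebra of observables `Λ*(H̃*(M, Ω))`. -/
abbrev Observables : Type _ := GradedComm.Alg (hamGrading Ω)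

/-- The degree involution `F ↦ (-1)^p F` for `F` of form degree `p`. -/
def hamSign : HamSpace Ω →ₗ[ℝ] HamSpace Ω :=
  DirectSum.lmap fun p => (-1 : ℝ) ^ (p : ℕ) • LinearMap.id

theorem hamSign_apply (p : ℕ) : ∀ F ∈ hamGrading Ω p, hamSign Ω F = (-1 : ℝ) ^ p • F := by
  intro F hF
  ext i : 1
  rw [DirectSum.smul_apply]
  by_cases hi : (i : ℕ) = p
  · simp [hamSign, hi]
  · simp [hamSign, hF i hi]

theorem lof_mem_hamGrading (p : Fin (k + 1)) (F : HamQuot Ω p) :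
    DirectSum.lof ℝ (Fin (k + 1)) (HamQuot Ω) p F ∈ hamGrading Ω p := by
  intro i hi
  exact DFinsupp.single_eq_of_ne fun h => hi (congrArg Fin.val h)

theorem iSup_hamGrading : ⨆ p, hamGrading Ω p = ⊤ := by
  rw [eq_top_iff]
  rintro F -
  induction F using DirectSum.induction_on with
  | zero => exact Submodule.zero_mem _
  | of p F => exact Submodule.mem_iSup_of_mem (p : ℕ) (lof_mem_hamGrading Ω p F)
  | add F F' h h' => exact Submodule.add_mem _ h h'

/-- The injection `[F] ↦ dF` of Hamiltonian `p`-forms modulo closed forms into `(p+1)`-forms. -/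
def quotD (p : Fin (k + 1)) : HamQuot Ω p →ₗ[ℝ] FormField E M ((p : ℕ) + 1) :=
  (LinearMap.ker (hamD Ω p)).liftQ (hamD Ω p) le_rfl

theorem quotD_mk (p : Fin (k + 1)) (F : hamiltonianForms Ω p) :
    quotD Ω p (HamQuot.mk Ω p F) = hamD Ω p F := rfl

theorem quotD_injective (p : Fin (k + 1)) : Function.Injective (quotD Ω p) :=
  LinearMap.ker_eq_bot.mp (Submodule.ker_liftQ_eq_bot _ _ _ le_rfl)

variable {EG G : Type*} [NormedAddCommGroup EG] [NormedSpace ℝ EG] [TopologicalSpace G]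
  [ChartedSpace EG G] [Group G]

/-- The vector field `ξ_M` of a Lie algebra element `ξ`, with the sign for which `ξ ↦ ξ_M` is a
homomorphism of Lie algebras: `ξ_M(x) = d/dt exp(-tξ) • x` at `t = 0`. -/
def fundamentalField [MulAction G M] (ξ : GroupLieAlgebra 𝓘(ℝ, EG) G) (x : M) :
    TangentSpace 𝓘(ℝ, E) x :=
  (mfderiv 𝓘(ℝ, EG) 𝓘(ℝ, E) (fun g : G => g⁻¹ • x) 1 ξ : E)

/-- The action of `G` preserves `Ω`. -/
def IsMultisymplecticAction (G : Type*) [Group G] [MulAction G M] : Prop :=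
  ∀ (g : G) (x : M) (v : Fin (k + 2) → TangentSpace 𝓘(ℝ, E) x),
    Ω.1 (g • x) (fun i => mfderiv 𝓘(ℝ, E) 𝓘(ℝ, E) (fun y : M => g • y) x (v i)) = Ω.1 x v

variable (EG G) in
/-- A covariant momentum map `J`, given by the Noether currents `δ(ξ) = ⟨ξ, J⟩`: Hamiltonian
`(n-1)`-forms, depending linearly on `ξ`, with `dδ(ξ) = ξ_M ⌟ Ω`. -/
structure CovariantMomentumMap [MulAction G M] where
  δ : GroupLieAlgebra 𝓘(ℝ, EG) G →ₗ[ℝ] hamiltonianForms Ω (Fin.last k)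
  d_δ : ∀ (ξ : GroupLieAlgebra 𝓘(ℝ, EG) G) (x : M) (v : Fin (k + 1) → TangentSpace 𝓘(ℝ, E) x),
    hamD Ω (Fin.last k) (δ ξ) x v = Ω.1 x (Fin.cons (fundamentalField ξ x) v)

namespace CovariantMomentumMap

variable {Ω} [MulAction G M] (J : CovariantMomentumMap Ω EG G)

/-- The span `𝔚` of the `n`-forms `dδ(ξ)`. -/
def W : Submodule ℝ (FormField E M (k + 1)) :=
  LinearMap.range (hamD Ω (Fin.last k) ∘ₗ J.δ)

/-- The element `dδ(ξ)` of `𝔚`. -/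
def w (ξ : GroupLieAlgebra 𝓘(ℝ, EG) G) : J.W := ⟨hamD Ω (Fin.last k) (J.δ ξ), ξ, rfl⟩

theorem W_le_range : J.W ≤ LinearMap.range (quotD Ω (Fin.last k)) := by
  rintro _ ⟨ξ, rfl⟩
  exact ⟨HamQuot.mk Ω _ (J.δ ξ), rfl⟩

/-- The linear map `𝔚 → H̃^(n-1)(M, Ω)`, `dδ(ξ) ↦ δ(ξ)`. -/
def current : J.W →ₗ[ℝ] HamQuot Ω (Fin.last k) :=
  (LinearEquiv.ofInjective _ (quotD_injective Ω (Fin.last k))).symm.toLinearMap ∘ₗ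
    Submodule.inclusion J.W_le_range

theorem current_w (ξ : GroupLieAlgebra 𝓘(ℝ, EG) G) :
    J.current (J.w ξ) = HamQuot.mk Ω (Fin.last k) (J.δ ξ) := by
  rw [current, LinearMap.comp_apply, LinearEquiv.coe_coe, LinearEquiv.symm_apply_eq]
  rfl

/-- The map `dδ(ξ) ↦ δ(ξ)` into the graded space of Hamiltonian forms modulo closed forms. -/
def koszulMap : J.W →ₗ[ℝ] HamSpace Ω :=
  DirectSum.lof ℝ (Fin (k + 1)) (HamQuot Ω) (Fin.last k) ∘ₗ J.current

theorem koszulMap_mem (w : J.W) : J.koszulMap w ∈ hamGrading Ω k :=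
  lof_mem_hamGrading Ω (Fin.last k) _

/-- The ideal `Λ*(H̃*(M, Ω)) ∧ δ[𝔤]` generated by the covariant Noether currents. -/
def noetherIdeal : Ideal (Observables Ω) :=
  Ideal.span (Set.range fun ξ : GroupLieAlgebra 𝓘(ℝ, EG) G => GradedComm.ι (hamGrading Ω)
    (DirectSum.lof ℝ (Fin (k + 1)) (HamQuot Ω) (Fin.last k) (HamQuot.mk Ω _ (J.δ ξ))))

theorem noetherIdeal_eq : J.noetherIdeal = Koszul.ideal (hamGrading Ω) J.koszulMap := by
  rw [noetherIdeal, Koszul.ideal]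
  congr 1
  ext F
  constructor
  · rintro ⟨ξ, rfl⟩
    exact ⟨J.w ξ, by simp [koszulMap, current_w]⟩
  · rintro ⟨⟨_, ξ, rfl⟩, rfl⟩
    exact ⟨ξ, congrArg (fun F => GradedComm.ι (hamGrading Ω)
      (DirectSum.lof ℝ (Fin (k + 1)) (HamQuot Ω) (Fin.last k) F)) (J.current_w ξ).symm⟩

instance : J.noetherIdeal.IsTwoSided := by
  rw [noetherIdeal_eq]
  exact Koszul.ideal_isTwoSided _ k (iSup_hamGrading Ω) _ J.koszulMap_mem

/-- The algebra of observables on the constraint submanifold `J = 0`: the observables modulo the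
ideal generated by the covariant Noether currents. -/
abbrev ConstraintObservables : Type _ := Observables Ω ⧸ J.noetherIdeal

/-- The underlying algebra `Λ*(H̃*(M, Ω)) ∧ Λ*(𝔚)` of the Koszul complex, with `𝔚` in form
degree `n`. -/
abbrev KoszulAlg : Type _ := Koszul.KAlg (hamGrading Ω) k J.W

/-- The Koszul differential, with `F ↦ 0` for Hamiltonian forms `F` and `dδ(ξ) ↦ δ(ξ)`. -/
def koszulDiff : J.KoszulAlg →ₗ[ℝ] J.KoszulAlg :=
  Koszul.diff (hamGrading Ω) k (hamSign Ω) (hamSign_apply Ω) J.koszulMap J.koszulMap_mem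

/-- The homology of the Koszul complex at `Λ*(H̃*(M, Ω)) ∧ Λ^r(𝔚)`. -/
abbrev KoszulHomology (r : ℕ) : Type _ :=
  Koszul.homology (hamGrading Ω) k (hamSign Ω) (hamSign_apply Ω) J.koszulMap J.koszulMap_mem r

/-- The class of `F ∧ 1` in the Koszul homology in degree `0`. -/
def koszulClass (F : Observables Ω) : J.KoszulHomology 0 :=
  Koszul.obsClass (hamGrading Ω) k (hamSign Ω) (hamSign_apply Ω) J.koszulMap J.koszulMap_mem F

end CovariantMomentumMap

end Multisymplectic

/-! The generators of `𝔚` are themselves the forms `dδ(ξ)`, and a Hamiltonian form modulo closed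
forms is determined by its differential. So `ν : dδ(ξ) ↦ [δ(ξ)]` is an injective linear map from `𝔚`
to `H̃^(n-1)`, and over a field it has a left inverse `π`, which can be taken to vanish in all form
degrees other than `n - 1`. No regularity of the currents is needed beyond this.

Positive degrees: extend `π` to a right derivation `h` of degree `+1` that kills `𝔚` (`homotopy`).
The anticommutator `N = dh + hd` (`laplacian`) is an ungraded derivation (`laplacian_mul`), commutes
with `d`, and acts on generators as the projection onto `ν(𝔚) ⊕ 𝔚` along `ker π` (`laplacian_ι`).
Hence `N` counts the factors from `ν(𝔚) ⊕ 𝔚`: the algebra is a sum of eigenspaces with natural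
eigenvalues, and at least `r` factors occur in `Λ*(V) ∧ Λ^r(𝔚)`. For `r > 0` every element there
lies in eigenspaces with nonzero eigenvalue, so each cycle `z` equals `N y`, where `y` is a
polynomial in `N` applied to `z`. Then `y` is a cycle too, and `z = d(h y)`
(`cycles_le_boundaries`).

Degree zero: `Λ*(V)` embeds in the Koszul algebra and is all of the degree-zero cycles; its
boundaries are the sums of products `F ∧ ν(w)`, that is, the ideal generated by the currents
(`obs_mem_boundaries_iff`). -/

namespace GradedComm

variable {V : Type*} [AddCommGroup V] [Module ℝ V] (𝒱 : ℕ → Submodule ℝ V)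

theorem sign_ι (s : V →ₗ[ℝ] V) (hs : ∀ p, ∀ v ∈ 𝒱 p, s v = (-1 : ℝ) ^ p • v) (v : V) :
    sign 𝒱 s hs (ι 𝒱 v) = ι 𝒱 (s v) := by
  simp [sign]

/-- The grading involution is an involution. -/
theorem sign_sign (s : V →ₗ[ℝ] V) (hs : ∀ p, ∀ v ∈ 𝒱 p, s v = (-1 : ℝ) ^ p • v)
    (hss : ∀ v, s (s v) = v) (a : Alg 𝒱) : sign 𝒱 s hs (sign 𝒱 s hs a) = a := by
  induction a using induction with
  | hr r => simp
  | hι v => rw [sign_ι, sign_ι, hss]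
  | hmul a b ha hb => simp [ha, hb]
  | hadd a b ha hb => simp [ha, hb]

/-! ### Right derivations of degree `+1` -/

section RaisingDerivation

variable (s η : V →ₗ[ℝ] V) (hs : ∀ p, ∀ v ∈ 𝒱 p, s v = (-1 : ℝ) ^ p • v)
  (hη : ∀ p, ∀ v ∈ 𝒱 p, η v ∈ 𝒱 (p + 1))

/-- The algebra homomorphism `a ↦ !![a, ah; 0, ±a]` for a right derivation `h` of degree `1`. -/
def raisingDerAux : Alg 𝒱 →ₐ[ℝ] Matrix (Fin 2) (Fin 2) (Alg 𝒱) :=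
  lift 𝒱
    { toFun := fun v => !![ι 𝒱 v, ι 𝒱 (η v); 0, ι 𝒱 (s v)]
      map_add' := fun v w => by ext i j; fin_cases i <;> fin_cases j <;> simp
      map_smul' := fun c v => by ext i j; fin_cases i <;> fin_cases j <;> simp }
    (by
      intro p q x y hx hy
      -- The exponent is `p * (q + 1)`, because `η y` has degree `q + 1`.
      have hd : ∀ (p q : ℕ) (x y : V), x ∈ 𝒱 p → y ∈ 𝒱 q →
          ι 𝒱 x * ι 𝒱 (η y) = (-1 : ℝ) ^ (p * q + p) • (ι 𝒱 (η y) * ι 𝒱 x) :=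
        fun p q x y hx hy => ι_mul_ι 𝒱 hx (hη q y hy)
      have hsq : ∀ m : ℕ, (-1 : ℝ) ^ m * (-1 : ℝ) ^ m = 1 := fun m => by
        rw [← mul_pow]; simp
      ext i j
      fin_cases i <;> fin_cases j
      · simpa using ι_mul_ι 𝒱 hx hy
      · have h1 := hd p q x y hx hy
        have h2 := hd q p y x hy hx
        simp only [Fin.zero_eta, Fin.isValue, LinearMap.coe_mk, AddHom.coe_mk, Fin.mk_one,
          Matrix.mul_apply, Fin.sum_univ_two, Matrix.of_apply, Matrix.cons_val', Matrix.cons_val_zero,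
          Matrix.cons_val_one, Matrix.cons_val_fin_one, Matrix.smul_apply, hs p x hx, hs q y hy,
          map_smul, Algebra.mul_smul_comm, smul_add, smul_smul]
        -- Both sides become combinations of `ηx · y` and `ηy · x`. The coefficients agree because
        -- `(-1)^(pq)` squares to `1`.
        rw [h1, h2, smul_smul, add_comm]
        congr 1
        · congr 1
          rw [pow_add, mul_comm q p, ← mul_assoc, hsq, one_mul]
        · rw [pow_add]
      · simp
      · have h := ι_mul_ι 𝒱 hx hy
        simp only [Fin.mk_one, Fin.isValue, LinearMap.coe_mk, AddHom.coe_mk, Matrix.mul_apply,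
          Fin.sum_univ_two, Matrix.of_apply, Matrix.cons_val', Matrix.cons_val_zero,
          Matrix.cons_val_one, Matrix.cons_val_fin_one, Matrix.smul_apply, hs p x hx, hs q y hy,
          map_smul, zero_mul, zero_add, smul_mul_smul_comm, h, smul_smul]
        congr 1
        ring)

/-- The right derivation of degree `1` of `Λ*(V)` which extends the linear map `η : V → V` of
degree `1`. -/
def raisingDer : Alg 𝒱 →ₗ[ℝ] Alg 𝒱 where
  toFun a := raisingDerAux 𝒱 s η hs hη a 0 1
  map_add' a b := by simp
  map_smul' c a := by simp

/-- The matrices are upper triangular, so their diagonal entries are multiplicative in `a` and are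
determined by the generators. -/
theorem raisingDerAux_apply (a : Alg 𝒱) :
    raisingDerAux 𝒱 s η hs hη a = !![a, raisingDer 𝒱 s η hs hη a; 0, sign 𝒱 s hs a] := by
  have h00 : ∀ a, raisingDerAux 𝒱 s η hs hη a 0 0 = a ∧ raisingDerAux 𝒱 s η hs hη a 1 0 = 0 ∧
      raisingDerAux 𝒱 s η hs hη a 1 1 = sign 𝒱 s hs a := by
    intro a
    induction a using induction with
    | hr r => simp [Matrix.algebraMap_matrix_apply]
    | hι v => simp [raisingDerAux, sign]
    | hmul a b ha hb => simp [Matrix.mul_apply, Fin.sum_univ_two, ha, hb]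
    | hadd a b ha hb => simp [ha, hb]
  ext i j
  fin_cases i <;> fin_cases j
  · exact (h00 a).1
  · rfl
  · exact (h00 a).2.1
  · exact (h00 a).2.2

@[simp]
theorem raisingDer_ι (v : V) : raisingDer 𝒱 s η hs hη (ι 𝒱 v) = ι 𝒱 (η v) := by
  simp [raisingDer, raisingDerAux]

@[simp]
theorem raisingDer_algebraMap (r : ℝ) : raisingDer 𝒱 s η hs hη (algebraMap ℝ _ r) = 0 := by
  simp [raisingDer, Matrix.algebraMap_matrix_apply]

/-- This is the upper right entry of a product of two upper triangular matrices. -/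
theorem raisingDer_mul (a b : Alg 𝒱) :
    raisingDer 𝒱 s η hs hη (a * b) =
      a * raisingDer 𝒱 s η hs hη b + raisingDer 𝒱 s η hs hη a * sign 𝒱 s hs b := by
  have h := congrFun (congrFun (map_mul (raisingDerAux 𝒱 s η hs hη) a b) 0) 1
  rw [raisingDerAux_apply 𝒱 s η hs hη a, raisingDerAux_apply 𝒱 s η hs hη b] at h
  rw [Matrix.mul_apply, Fin.sum_univ_two] at h
  exact h

end RaisingDerivation

end GradedComm

/-! ### Inverting an endomorphism off its kernel by polynomials -/

section Eigenspaces

open Polynomial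

variable {K A : Type*} [Field K] [AddCommGroup A] [Module K A]

/-- A sum of eigenvectors for nonzero eigenvalues is annihilated by a polynomial in the
endomorphism with nonzero constant term. -/
theorem Module.End.exists_coeff_zero_ne_zero_of_mem_iSup_eigenspace (N : Module.End K A) {z : A}
    (hz : z ∈ ⨆ μ : {μ : K // μ ≠ 0}, N.eigenspace μ) :
    ∃ p : K[X], p.coeff 0 ≠ 0 ∧ aeval N p z = 0 := by
  induction hz using Submodule.iSup_induction' with
  | mem μ z hz =>
    refine ⟨X - C μ.1, by simpa using μ.2, ?_⟩
    rw [Module.End.mem_eigenspace_iff] at hz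
    simp [hz, Module.algebraMap_end_apply]
  | zero => exact ⟨1, by simp, by simp⟩
  | add x y _ _ hx hy =>
    obtain ⟨p, hp, hpx⟩ := hx
    obtain ⟨q, hq, hqy⟩ := hy
    -- Polynomials in `N` commute, so in `p * q` either factor may act first and kill its own
    -- summand.
    refine ⟨p * q, by simpa [mul_coeff_zero] using ⟨hp, hq⟩, ?_⟩
    rw [map_add]
    nth_rewrite 1 [mul_comm]
    simp [hpx, hqy]

/-- On a sum of eigenvectors for nonzero eigenvalues an endomorphism can be inverted by a
polynomial in the endomorphism. -/
theorem Module.End.exists_aeval_eq_of_mem_iSup_eigenspace (N : Module.End K A) {z : A}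
    (hz : z ∈ ⨆ μ : {μ : K // μ ≠ 0}, N.eigenspace μ) :
    ∃ q : K[X], N (aeval N q z) = z := by
  obtain ⟨p, hp, hpz⟩ := N.exists_coeff_zero_ne_zero_of_mem_iSup_eigenspace hz
  -- Since `p = X * divX p + p(0)`, the relation `p(N) z = 0` reads `N (divX p)(N) z = -p(0) z`, and
  -- `p(0)` is invertible.
  refine ⟨C (-(p.coeff 0)⁻¹) * p.divX, ?_⟩
  rw [← p.X_mul_divX_add] at hpz
  simp only [map_add, map_mul, aeval_X, aeval_C, LinearMap.add_apply, Module.End.mul_apply,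
    Module.algebraMap_end_apply] at hpz ⊢
  rw [map_smul, eq_neg_of_add_eq_zero_left hpz, smul_neg, neg_smul, neg_neg, smul_smul,
    inv_mul_cancel₀ hp, one_smul]

theorem Module.End.aeval_apply_mem_of_forall_mem (N : Module.End K A) (S : Submodule K A)
    (hN : ∀ x ∈ S, N x ∈ S) (q : K[X]) {z : A} (hz : z ∈ S) : aeval N q z ∈ S := by
  induction q using Polynomial.induction_on generalizing z with
  | C c => simpa [Module.algebraMap_end_apply] using S.smul_mem c hz
  | add p q hp hq => simpa using S.add_mem (hp hz) (hq hz)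
  | monomial n c h =>
    rw [pow_succ, ← mul_assoc, map_mul, aeval_X]
    exact h (hN z hz)

end Eigenspaces

namespace Koszul

open GradedComm

variable {V W : Type*} [AddCommGroup V] [Module ℝ V] [AddCommGroup W] [Module ℝ W]
  (𝒱 : ℕ → Submodule ℝ V) (k : ℕ)

theorem wedge_eq (w : W) : wedge 𝒱 k w = ι (gens 𝒱 k W) (0, w) := rfl

/-- Setting the generators in `W` to zero gives a retraction `ρ` onto `Λ*(V)`. -/
theorem obs_injective : Function.Injective (obs 𝒱 k W) := by
  let ρ : KAlg 𝒱 k W →ₐ[ℝ] Alg 𝒱 := map (gens 𝒱 k W) 𝒱 (LinearMap.fst ℝ V W) fun _ _ hv => hv.1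
  refine Function.LeftInverse.injective (g := ρ) fun a => ?_
  induction a using induction with
  | hr r => simp
  | hι v => rw [obs_ι]; exact map_ι _ _ _ _ _
  | hmul a b ha hb => rw [map_mul, map_mul, ha, hb]
  | hadd a b ha hb => rw [map_add, map_add, ha, hb]

/-! ### The contracting homotopy -/

section Homotopy

variable (s : V →ₗ[ℝ] V) (hs : ∀ p, ∀ v ∈ 𝒱 p, s v = (-1 : ℝ) ^ p • v)
  (π : V →ₗ[ℝ] W) (hπ : ∀ p, p ≠ k → ∀ v ∈ 𝒱 p, π v = 0)

/-- The contracting homotopy on the generators. -/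
def genHomotopy : V × W →ₗ[ℝ] V × W :=
  LinearMap.inr ℝ V W ∘ₗ π ∘ₗ LinearMap.fst ℝ V W

@[simp]
theorem genHomotopy_apply (x : V × W) : genHomotopy π x = (0, π x.1) := rfl

@[simp]
theorem genDiff_apply (ν : W →ₗ[ℝ] V) (x : V × W) : genDiff ν x = (ν x.2, 0) := rfl

-- The vanishing of `π` outside degree `k` is what makes the homotopy homogeneous: `W` sits only in
-- degree `k + 1`.
include hπ in
theorem genHomotopy_mem (p : ℕ) :
    ∀ x ∈ gens 𝒱 k W p, genHomotopy π x ∈ gens 𝒱 k W (p + 1) := by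
  intro x hx
  refine ⟨Submodule.zero_mem _, ?_⟩
  by_cases hp : p = k
  · simp [hp]
  · simp [hπ p hp x.1 hx.1]

/-- The contracting homotopy: the right derivation of degree `1` of `Λ*(V) ∧ Λ*(W)` which extends
`π : V → W` and vanishes on `W`. -/
def homotopy : KAlg 𝒱 k W →ₗ[ℝ] KAlg 𝒱 k W :=
  raisingDer (gens 𝒱 k W) (genSign k s W) (genHomotopy π) (genSign_apply 𝒱 k s hs)
    (genHomotopy_mem 𝒱 k π hπ)

theorem homotopy_mul (a b : KAlg 𝒱 k W) :
    homotopy 𝒱 k s hs π hπ (a * b) = a * homotopy 𝒱 k s hs π hπ b +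
      homotopy 𝒱 k s hs π hπ a * sign _ (genSign k s W) (genSign_apply 𝒱 k s hs) b :=
  raisingDer_mul _ _ _ _ _ a b

theorem homotopy_algebraMap (r : ℝ) : homotopy 𝒱 k s hs π hπ (algebraMap ℝ _ r) = 0 :=
  raisingDer_algebraMap _ _ _ _ _ r

theorem homotopy_ι (x : V × W) :
    homotopy 𝒱 k s hs π hπ (ι (gens 𝒱 k W) x) = wedge 𝒱 k (π x.1) :=
  raisingDer_ι _ _ _ _ _ x

include hs hπ in
/-- `π` intertwines the degree involution with a sign. -/
theorem map_involution (hV : ⨆ p, 𝒱 p = ⊤) (v : V) : π (s v) = (-1 : ℝ) ^ k • π v := by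
  have hv : v ∈ ⨆ p, 𝒱 p := hV ▸ Submodule.mem_top
  induction hv using Submodule.iSup_induction' with
  | mem p v hv =>
    by_cases hp : p = k
    · subst hp; rw [hs p v hv, map_smul]
    · rw [hs p v hv, map_smul, hπ p hp v hv, smul_zero, smul_zero]
  | zero => simp
  | add x y _ _ hx hy => simp only [map_add, hx, hy, smul_add]

include hs in
theorem involution_involution (hV : ⨆ p, 𝒱 p = ⊤) (v : V) : s (s v) = v := by
  have hv : v ∈ ⨆ p, 𝒱 p := hV ▸ Submodule.mem_top
  induction hv using Submodule.iSup_induction' with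
  | mem p v hv => rw [hs p v hv, map_smul, hs p v hv, smul_smul, ← mul_pow]; simp
  | zero => simp
  | add x y _ _ hx hy => simp only [map_add, hx, hy]

theorem sign_sign_gens (hV : ⨆ p, 𝒱 p = ⊤) (a : KAlg 𝒱 k W) :
    sign _ (genSign k s W) (genSign_apply 𝒱 k s hs)
      (sign _ (genSign k s W) (genSign_apply 𝒱 k s hs) a) = a := by
  refine sign_sign _ _ _ (fun x => ?_) a
  ext
  · simp [genSign, involution_involution 𝒱 s hs hV]
  · simp [genSign, smul_smul, ← mul_pow]

/-- The homotopy shifts the degree by one, hence reverses parity. That the homogeneous vectors span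
`V` is needed because `s` is prescribed on these only. -/
theorem sign_homotopy (hV : ⨆ p, 𝒱 p = ⊤) (a : KAlg 𝒱 k W) :
    sign _ (genSign k s W) (genSign_apply 𝒱 k s hs) (homotopy 𝒱 k s hs π hπ a) =
      - homotopy 𝒱 k s hs π hπ (sign _ (genSign k s W) (genSign_apply 𝒱 k s hs) a) := by
  induction a using induction with
  | hr r => rw [AlgHom.commutes, homotopy_algebraMap, map_zero, neg_zero]
  | hι x =>
    rw [homotopy_ι, wedge_eq, sign_ι, sign_ι, homotopy_ι, wedge_eq, ← map_neg]
    congr 1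
    simp [genSign, map_involution 𝒱 k s hs π hπ hV, pow_succ]
  | hmul a b ha hb =>
    rw [homotopy_mul, map_add, map_mul, map_mul, map_mul, homotopy_mul, ha, hb]
    noncomm_ring
  | hadd a b ha hb => simp only [map_add, ha, hb]; abel

theorem sign_obs_mem (a : Alg 𝒱) :
    sign _ (genSign k s W) (genSign_apply 𝒱 k s hs) (obs 𝒱 k W a) ∈ (obs 𝒱 k W).range := by
  refine ⟨sign 𝒱 s hs a, ?_⟩
  induction a using induction with
  | hr r => simp
  | hι v =>
    change obs 𝒱 k W _ = _
    rw [sign_ι, obs_ι, obs_ι, sign_ι]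
    simp [genSign]
  | hmul a b ha hb => simp only [map_mul, ha, hb]
  | hadd a b ha hb => simp only [map_add, ha, hb]

theorem homotopy_obs_mem (hV : ⨆ p, 𝒱 p = ⊤) (a : Alg 𝒱) :
    homotopy 𝒱 k s hs π hπ (obs 𝒱 k W a) ∈
      Subalgebra.toSubmodule (obs 𝒱 k W).range * LinearMap.range (wedge (W := W) 𝒱 k) := by
  set A := Subalgebra.toSubmodule (obs 𝒱 k W).range with hA
  set U := LinearMap.range (wedge (W := W) 𝒱 k) with hU
  have hAA : A * A = A := Subalgebra.isIdempotentElem_toSubmodule _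
  induction a using induction with
  | hr r =>
    rw [AlgHom.commutes, homotopy_algebraMap]
    exact Submodule.zero_mem _
  | hι v =>
    rw [obs_ι, homotopy_ι, ← one_mul (wedge 𝒱 k _)]
    exact Submodule.mul_mem_mul (one_mem (obs 𝒱 k W).range) ⟨_, rfl⟩
  | hmul a b ha hb =>
    rw [map_mul, homotopy_mul]
    refine Submodule.add_mem _ ?_ ?_
    · have h := Submodule.mul_mem_mul (show obs 𝒱 k W a ∈ A from ⟨a, rfl⟩) hb
      rwa [← mul_assoc, hAA] at h
    -- This term lies in `A * U * A`; commuting `U` past the right-hand `A` brings it back to `A *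
    -- U`.
    · have h := Submodule.mul_mem_mul ha
        (show _ ∈ A from sign_obs_mem (W := W) 𝒱 k s hs b)
      rw [mul_assoc] at h
      have h' := mul_le_mul' (le_refl A) (range_wedge_mul_le (W := W) 𝒱 k hV) h
      rwa [← mul_assoc, hAA] at h'
  | hadd a b ha hb =>
    rw [map_add, map_add]
    exact Submodule.add_mem _ ha hb

/-- A derivation that vanishes on `W` vanishes on all products of elements of `W`. -/
theorem homotopy_pow_wedge (r : ℕ) : ∀ u ∈ (LinearMap.range (wedge (W := W) 𝒱 k)) ^ r,
    homotopy 𝒱 k s hs π hπ u = 0 := by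
  intro u hu
  induction r generalizing u with
  | zero =>
    rw [pow_zero, Submodule.one_eq_range] at hu
    obtain ⟨c, rfl⟩ := hu
    exact homotopy_algebraMap 𝒱 k s hs π hπ c
  | succ r ih =>
    rw [pow_succ] at hu
    refine Submodule.mul_induction_on hu ?_ ?_
    · rintro a ha _ ⟨w, rfl⟩
      rw [homotopy_mul, ih a ha, wedge_eq, homotopy_ι]
      simp
    · intro x y hx hy
      rw [map_add, hx, hy, add_zero]

/-- The homotopy maps `Λ*(V) ∧ Λ^r(W)` into `Λ*(V) ∧ Λ^(r+1)(W)`. -/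
theorem homotopy_mem_comp (hV : ⨆ p, 𝒱 p = ⊤) (r : ℕ) {a : KAlg 𝒱 k W}
    (ha : a ∈ comp 𝒱 k W r) : homotopy 𝒱 k s hs π hπ a ∈ comp 𝒱 k W (r + 1) := by
  refine Submodule.mul_induction_on ha ?_ ?_
  · rintro _ ⟨c, rfl⟩ u hu
    change homotopy 𝒱 k s hs π hπ (obs 𝒱 k W c * u) ∈ _
    -- Only `h(c) · (±u)` survives in the product rule, and `h(c)` contributes exactly one new
    -- factor from `W`.
    rw [homotopy_mul, homotopy_pow_wedge 𝒱 k s hs π hπ r u hu, mul_zero, zero_add, comp,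
      pow_succ', ← mul_assoc]
    exact Submodule.mul_mem_mul (homotopy_obs_mem 𝒱 k s hs π hπ hV c)
      (sign_mem_pow 𝒱 k s hs r u hu)
  · intro x y hx hy
    rw [map_add]
    exact Submodule.add_mem _ hx hy

/-! ### The Laplacian and its eigenspaces -/

variable (ν : W →ₗ[ℝ] V) (hν : ∀ w, ν w ∈ 𝒱 k)

/-- The anticommutator of the Koszul differential and the homotopy; it counts the factors in
`ν(W) ⊕ W`. -/
def laplacian : Module.End ℝ (KAlg 𝒱 k W) :=
  diff 𝒱 k s hs ν hν ∘ₗ homotopy 𝒱 k s hs π hπ + homotopy 𝒱 k s hs π hπ ∘ₗ diff 𝒱 k s hs ν hν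

theorem laplacian_apply (a : KAlg 𝒱 k W) :
    laplacian 𝒱 k s hs π hπ ν hν a = diff 𝒱 k s hs ν hν (homotopy 𝒱 k s hs π hπ a) +
      homotopy 𝒱 k s hs π hπ (diff 𝒱 k s hs ν hν a) := rfl

/-- The cross terms cancel because both the differential and the homotopy anticommute with the
grading involution; the two twists on the last factor cancel because that map is an involution. -/
theorem laplacian_mul (hV : ⨆ p, 𝒱 p = ⊤) (a b : KAlg 𝒱 k W) :
    laplacian 𝒱 k s hs π hπ ν hν (a * b) =
      a * laplacian 𝒱 k s hs π hπ ν hν b + laplacian 𝒱 k s hs π hπ ν hν a * b := by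
  simp only [laplacian_apply, diff_mul, homotopy_mul, map_add, sign_diff, sign_homotopy _ _ _ _ _ _ hV,
    sign_sign_gens 𝒱 k s hs hV]
  noncomm_ring

theorem laplacian_diff (a : KAlg 𝒱 k W) :
    laplacian 𝒱 k s hs π hπ ν hν (diff 𝒱 k s hs ν hν a) =
      diff 𝒱 k s hs ν hν (laplacian 𝒱 k s hs π hπ ν hν a) := by
  simp only [laplacian_apply, map_add, diff_diff, map_zero, add_zero, zero_add]

theorem laplacian_ι (hπν : ∀ w, π (ν w) = w) (x : V × W) :
    laplacian 𝒱 k s hs π hπ ν hν (ι (gens 𝒱 k W) x) = ι (gens 𝒱 k W) (ν (π x.1), x.2) := by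
  have hd : ∀ y : V × W,
      diff 𝒱 k s hs ν hν (ι (gens 𝒱 k W) y) = ι (gens 𝒱 k W) (ν y.2, 0) := fun y =>
    rightDer_ι _ _ _ _ _ _ y
  rw [laplacian_apply, homotopy_ι, hd, homotopy_ι, wedge_eq, wedge_eq, hd, ← map_add]
  simp [hπν]

theorem laplacian_algebraMap (c : ℝ) :
    laplacian 𝒱 k s hs π hπ ν hν (algebraMap ℝ _ c) = 0 := by
  have h : diff 𝒱 k s hs ν hν (algebraMap ℝ _ c) = 0 := rightDer_algebraMap _ _ _ _ _ _ c
  rw [laplacian_apply, h, homotopy_algebraMap, map_zero, map_zero, add_zero]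

/-- Eigenvalues of a derivation add under multiplication. -/
theorem mul_mem_eigenspace (hV : ⨆ p, 𝒱 p = ⊤) {c d : ℝ} {a b : KAlg 𝒱 k W}
    (ha : a ∈ (laplacian 𝒱 k s hs π hπ ν hν).eigenspace c)
    (hb : b ∈ (laplacian 𝒱 k s hs π hπ ν hν).eigenspace d) :
    a * b ∈ (laplacian 𝒱 k s hs π hπ ν hν).eigenspace (c + d) := by
  rw [Module.End.mem_eigenspace_iff] at *
  rw [laplacian_mul _ _ _ _ _ _ _ _ hV, ha, hb, mul_smul_comm, smul_mul_assoc, add_smul, add_comm]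

/-- The algebra is spanned by eigenvectors of the Laplacian with natural eigenvalues. -/
theorem mem_iSup_eigenspace (hV : ⨆ p, 𝒱 p = ⊤) (hπν : ∀ w, π (ν w) = w) (a : KAlg 𝒱 k W) :
    a ∈ ⨆ m : ℕ, (laplacian 𝒱 k s hs π hπ ν hν).eigenspace (m : ℝ) := by
  induction a using induction with
  | hr c =>
    refine Submodule.mem_iSup_of_mem 0 ?_
    simp [laplacian_algebraMap]
  | hι x =>
    -- On generators the Laplacian is a projection; this splits `x` into its kernel part (eigenvalue
    -- `0`) and its image part (eigenvalue `1`).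
    rw [show x = (x.1 - ν (π x.1), (0 : W)) + (ν (π x.1), x.2) by simp, map_add]
    refine Submodule.add_mem _ (Submodule.mem_iSup_of_mem 0 ?_) (Submodule.mem_iSup_of_mem 1 ?_)
    · rw [Module.End.mem_eigenspace_iff, laplacian_ι _ _ _ _ _ _ _ _ hπν]
      simp [hπν, ← Prod.zero_eq_mk]
    · rw [Module.End.mem_eigenspace_iff, laplacian_ι _ _ _ _ _ _ _ _ hπν]
      simp [hπν]
  | hmul a b ha hb =>
    refine SetLike.le_def.mp ?_ (Submodule.mul_mem_mul ha hb)
    rw [Submodule.iSup_mul]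
    refine iSup_le fun i => ?_
    rw [Submodule.mul_iSup]
    refine iSup_le fun j => ?_
    rw [Submodule.mul_le]
    intro x hx y hy
    refine Submodule.mem_iSup_of_mem (i + j) ?_
    have := mul_mem_eigenspace 𝒱 k s hs π hπ ν hν hV hx hy
    rwa [← Nat.cast_add] at this
  | hadd a b ha hb => exact Submodule.add_mem _ ha hb

theorem pow_wedge_le_eigenspace (hV : ⨆ p, 𝒱 p = ⊤) (hπν : ∀ w, π (ν w) = w) (r : ℕ) :
    (LinearMap.range (wedge (W := W) 𝒱 k)) ^ r ≤
      (laplacian 𝒱 k s hs π hπ ν hν).eigenspace (r : ℝ) := by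
  induction r with
  | zero =>
    rw [pow_zero, Submodule.one_eq_range]
    rintro _ ⟨c, rfl⟩
    simp [laplacian_algebraMap]
  | succ r ih =>
    rw [pow_succ, Submodule.mul_le]
    rintro a ha _ ⟨w, rfl⟩
    rw [Nat.cast_succ]
    refine mul_mem_eigenspace 𝒱 k s hs π hπ ν hν hV (ih ha) ?_
    rw [Module.End.mem_eigenspace_iff, wedge_eq, laplacian_ι _ _ _ _ _ _ _ _ hπν]
    simp

/-- The factors in `W` contribute `r + 1` to the eigenvalue, and the coefficient in `Λ*(V)`
contributes a natural number, so the sum cannot vanish. -/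
theorem comp_le_iSup_eigenspace (hV : ⨆ p, 𝒱 p = ⊤) (hπν : ∀ w, π (ν w) = w) (r : ℕ) :
    comp 𝒱 k W (r + 1) ≤
      ⨆ μ : {μ : ℝ // μ ≠ 0}, (laplacian 𝒱 k s hs π hπ ν hν).eigenspace μ := by
  rw [comp, Submodule.mul_le]
  rintro a - u hu
  have hu := pow_wedge_le_eigenspace 𝒱 k s hs π hπ ν hν hV hπν (r + 1) hu
  have ha := mem_iSup_eigenspace 𝒱 k s hs π hπ ν hν hV hπν a
  induction ha using Submodule.iSup_induction' with
  | mem m a ha =>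
    have hne : (m : ℝ) + ((r + 1 : ℕ) : ℝ) ≠ 0 := by positivity
    exact Submodule.mem_iSup_of_mem ⟨_, hne⟩ (mul_mem_eigenspace 𝒱 k s hs π hπ ν hν hV ha hu)
  | zero => rw [zero_mul]; exact Submodule.zero_mem _
  | add x y _ _ hx hy => rw [add_mul]; exact Submodule.add_mem _ hx hy

include hπ in
/-- The Koszul complex is exact in positive degrees if `ν` has a graded left inverse. -/
theorem cycles_le_boundaries (hV : ⨆ p, 𝒱 p = ⊤) (hπν : ∀ w, π (ν w) = w) (r : ℕ) :
    cycles 𝒱 k s hs ν hν (r + 1) ≤ boundaries 𝒱 k s hs ν hν (r + 1) := by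
  rintro z hz
  have hbc : ∀ x ∈ comp 𝒱 k W (r + 1), diff 𝒱 k s hs ν hν x ∈ comp 𝒱 k W r := fun x hx =>
    (boundaries_le_cycles 𝒱 k s hs ν hν hV r ⟨x, hx, rfl⟩).1
  have hbc' : ∀ x ∈ comp 𝒱 k W (r + 2), diff 𝒱 k s hs ν hν x ∈ comp 𝒱 k W (r + 1) := fun x hx =>
    (boundaries_le_cycles 𝒱 k s hs ν hν hV (r + 1) ⟨x, hx, rfl⟩).1
  obtain ⟨q, hq⟩ := (laplacian 𝒱 k s hs π hπ ν hν).exists_aeval_eq_of_mem_iSup_eigenspace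
    (comp_le_iSup_eigenspace 𝒱 k s hs π hπ ν hν hV hπν r hz.1)
  -- The Laplacian preserves `comp 𝒱 k W (r + 1)`, since each summand goes one step up and one step
  -- down, and it commutes with the differential; so polynomials in it preserve cycles.
  have hmem := (laplacian 𝒱 k s hs π hπ ν hν).aeval_apply_mem_of_forall_mem
    (cycles 𝒱 k s hs ν hν (r + 1)) (fun x hx => ⟨Submodule.add_mem _
      (hbc' _ (homotopy_mem_comp 𝒱 k s hs π hπ hV _ hx.1))
      (homotopy_mem_comp 𝒱 k s hs π hπ hV _ (hbc x hx.1)), by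
        rw [SetLike.mem_coe, LinearMap.mem_ker, ← laplacian_diff, LinearMap.mem_ker.mp hx.2, map_zero]⟩) q hz
  refine ⟨_, homotopy_mem_comp 𝒱 k s hs π hπ hV _ hmem.1, ?_⟩
  -- On the cycle `y = q(N) z` the term `h(d y)` drops out, so `z = N y = d(h y)`.
  rw [laplacian_apply, LinearMap.mem_ker.mp hmem.2, map_zero, add_zero] at hq
  exact hq

end Homotopy

/-! ### Homology in degree zero -/

section DegreeZero

variable (s : V →ₗ[ℝ] V) (hs : ∀ p, ∀ v ∈ 𝒱 p, s v = (-1 : ℝ) ^ p • v)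
  (ν : W →ₗ[ℝ] V) (hν : ∀ w, ν w ∈ 𝒱 k)

/-- The differential sends `b ∧ w` to `b ∧ ν(w)`, and such products are exactly what spans the left
ideal generated by `ν(W)`; injectivity of `obs` transports this back to `Λ*(V)`. -/
theorem obs_mem_boundaries_iff (a : Alg 𝒱) :
    obs 𝒱 k W a ∈ boundaries 𝒱 k s hs ν hν 0 ↔ a ∈ ideal 𝒱 ν := by
  have hdiff : ∀ b w, diff 𝒱 k s hs ν hν (obs 𝒱 k W b * wedge 𝒱 k w) =
      obs 𝒱 k W (b * ι 𝒱 (ν w)) := fun b w => by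
    rw [diff_mul, diff_obs, zero_mul, add_zero, diff_wedge, map_mul]
  constructor
  · rintro ⟨z, hz, hza⟩
    suffices h : ∃ b ∈ ideal 𝒱 ν, obs 𝒱 k W b = diff 𝒱 k s hs ν hν z by
      obtain ⟨b, hb, hbz⟩ := h
      rwa [← obs_injective 𝒱 k (hbz.trans hza)]
    clear hza
    rw [SetLike.mem_coe, comp, zero_add, pow_one] at hz
    refine Submodule.mul_induction_on hz ?_ ?_
    · rintro _ ⟨b, rfl⟩ _ ⟨w, rfl⟩
      exact ⟨_, Ideal.mul_mem_left _ b (Ideal.subset_span ⟨w, rfl⟩), (hdiff b w).symm⟩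
    · rintro x y ⟨b, hb, hbx⟩ ⟨c, hc, hcy⟩
      exact ⟨b + c, add_mem hb hc, by rw [map_add, map_add, hbx, hcy]⟩
  · intro ha
    induction ha using Submodule.span_induction with
    | mem x hx =>
      obtain ⟨w, rfl⟩ := hx
      refine ⟨obs 𝒱 k W 1 * wedge 𝒱 k w, ?_, by rw [hdiff, one_mul]⟩
      rw [SetLike.mem_coe, comp, zero_add, pow_one]
      exact Submodule.mul_mem_mul ⟨1, rfl⟩ ⟨w, rfl⟩
    | zero => rw [map_zero]; exact Submodule.zero_mem _
    | add x y _ _ hx hy => rw [map_add]; exact Submodule.add_mem _ hx hy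
    | smul c x _ hx =>
      obtain ⟨z, hz, hzx⟩ := hx
      refine ⟨obs 𝒱 k W c * z, ?_, ?_⟩
      · have h := Submodule.mul_mem_mul
          (show obs 𝒱 k W c ∈ Subalgebra.toSubmodule (obs 𝒱 k W).range from ⟨c, rfl⟩) hz
        rwa [comp, ← mul_assoc, Subalgebra.isIdempotentElem_toSubmodule] at h
      · rw [diff_mul, diff_obs, zero_mul, add_zero, hzx, smul_eq_mul, map_mul]

/-- The map from `Λ*(V)` to the homology in degree `0`, `F ↦ [F ∧ 1]`, as a linear map. -/
def obsClassLinear : Alg 𝒱 →ₗ[ℝ] homology 𝒱 k s hs ν hν 0 :=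
  Submodule.mkQ _ ∘ₗ (obs 𝒱 k W).toLinearMap.codRestrict (cycles 𝒱 k s hs ν hν 0)
    (obs_mem_cycles 𝒱 k s hs ν hν)

theorem obsClassLinear_surjective : Function.Surjective (obsClassLinear 𝒱 k s hs ν hν) := by
  intro c
  obtain ⟨⟨z, hz⟩, rfl⟩ := Submodule.mkQ_surjective _ c
  have h := hz.1
  rw [comp, pow_zero, mul_one] at h
  obtain ⟨a, rfl⟩ := h
  exact ⟨a, rfl⟩

theorem obsClassLinear_eq_zero_iff (a : Alg 𝒱) :
    obsClassLinear 𝒱 k s hs ν hν a = 0 ↔ a ∈ ideal 𝒱 ν := by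
  rw [← obs_mem_boundaries_iff 𝒱 k s hs ν hν]
  exact Submodule.Quotient.mk_eq_zero _

end DegreeZero

end Koszul

/-! ### Splitting the map from `𝔚` to the Noether currents -/

namespace Multisymplectic.CovariantMomentumMap

variable {E M : Type*} [NormedAddCommGroup E] [NormedSpace ℝ E] [TopologicalSpace M]
  [ChartedSpace E M] {k : ℕ} {Ω : Form E M (k + 2)}
  {EG G : Type*} [NormedAddCommGroup EG] [NormedSpace ℝ EG] [TopologicalSpace G]
  [ChartedSpace EG G] [Group G] [MulAction G M] (J : CovariantMomentumMap Ω EG G)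

/-- On `𝔚` this map inverts `[F] ↦ dF`, so a linear relation among the currents modulo closed forms
is already one among the forms `dδ(ξ)`. -/
theorem current_injective : Function.Injective J.current :=
  (LinearEquiv.ofInjective _ (quotD_injective Ω (Fin.last k))).symm.injective.comp
    (Submodule.inclusion_injective J.W_le_range)

/-- The map `dδ(ξ) ↦ δ(ξ)` has a left inverse which vanishes on forms of degree other than
`n - 1`. -/
theorem exists_graded_leftInverse : ∃ π : HamSpace Ω →ₗ[ℝ] J.W,
    (∀ p, p ≠ k → ∀ F ∈ hamGrading Ω p, π F = 0) ∧ ∀ w, π (J.koszulMap w) = w := by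
  obtain ⟨ρ, hρ⟩ := J.current.exists_leftInverse_of_injective
    (LinearMap.ker_eq_bot.mpr J.current_injective)
  -- Projecting to form degree `k = n - 1` before applying the linear left inverse `ρ` forces the
  -- vanishing in the other degrees.
  refine ⟨ρ ∘ₗ DirectSum.component ℝ (Fin (k + 1)) (HamQuot Ω) (Fin.last k), ?_, fun w => ?_⟩
  · intro p hp F hF
    have h : F (Fin.last k) = 0 := hF _ (by simpa using hp.symm)
    exact (congrArg ρ h).trans (map_zero ρ)
  · rw [LinearMap.comp_apply, koszulMap, LinearMap.comp_apply, DirectSum.component.lof_self]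
    exact LinearMap.congr_fun hρ w

end Multisymplectic.CovariantMomentumMap

/-! ### Koszul homology of the algebra of observables -/

theorem theorem3p6
    {E M : Type*} [NormedAddCommGroup E] [NormedSpace ℝ E] [FiniteDimensional ℝ E]
    [TopologicalSpace M] [ChartedSpace E M] [IsManifold 𝓘(ℝ, E) ∞ M]
    {k : ℕ} (Ω : Multisymplectic.Form E M (k + 2)) (hΩ : Multisymplectic.IsMultisymplectic Ω)
    {EG G : Type*} [NormedAddCommGroup EG] [NormedSpace ℝ EG] [FiniteDimensional ℝ EG]
    [TopologicalSpace G] [ChartedSpace EG G] [Group G] [LieGroup 𝓘(ℝ, EG) ∞ G]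
    [MulAction G M] [ContMDiffSMul 𝓘(ℝ, EG) 𝓘(ℝ, E) ∞ G M]
    (hG : Multisymplectic.IsMultisymplecticAction Ω G)
    (J : Multisymplectic.CovariantMomentumMap Ω EG G) :
    (∀ r : ℕ, 0 < r → Subsingleton (J.KoszulHomology r)) ∧
    ∃ e : J.ConstraintObservables ≃ₗ[ℝ] J.KoszulHomology 0,
      ∀ F : Multisymplectic.Observables Ω, e (Ideal.Quotient.mk J.noetherIdeal F) =
        J.koszulClass F := by
  obtain ⟨π, hπ, hπν⟩ := J.exists_graded_leftInverse
  refine ⟨fun r hr => ?_, ?_⟩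
  · obtain ⟨r, rfl⟩ := Nat.exists_eq_succ_of_ne_zero hr.ne'
    rw [Submodule.Quotient.subsingleton_iff, Submodule.submoduleOf, Submodule.comap_subtype_eq_top]
    exact Koszul.cycles_le_boundaries _ k _ _ π hπ _ _ (Multisymplectic.iSup_hamGrading Ω) hπν r
  · let f : Multisymplectic.Observables Ω →ₗ[ℝ] J.ConstraintObservables :=
      (Ideal.Quotient.mkₐ ℝ J.noetherIdeal).toLinearMap
    have hf : Function.Surjective f := Ideal.Quotient.mk_surjective
    let g : Multisymplectic.Observables Ω →ₗ[ℝ] J.KoszulHomology 0 :=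
      Koszul.obsClassLinear _ k _ _ J.koszulMap J.koszulMap_mem
    have hg : Function.Surjective g := Koszul.obsClassLinear_surjective _ k _ _ _ _
    -- Both targets are quotients of the observables by the same subspace, the Noether ideal, which
    -- yields an isomorphism compatible with the two projections.
    have hker : LinearMap.ker f = LinearMap.ker g := by
      ext F
      rw [LinearMap.mem_ker, LinearMap.mem_ker, Koszul.obsClassLinear_eq_zero_iff,
        ← J.noetherIdeal_eq]
      exact Ideal.Quotient.eq_zero_iff_mem
    refine ⟨(f.quotKerEquivOfSurjective hf).symm ≪≫ₗ Submodule.quotEquivOfEq _ _ hker ≪≫ₗ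
      g.quotKerEquivOfSurjective hg, fun F => ?_⟩
    have h : (f.quotKerEquivOfSurjective hf).symm (Ideal.Quotient.mk J.noetherIdeal F) =
        Submodule.Quotient.mk F := by
      rw [LinearEquiv.symm_apply_eq]
      rfl
    rw [LinearEquiv.trans_apply, LinearEquiv.trans_apply, h]
    rfl
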